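/- A Motzkin path of length $n\ge 0$ is a sequence $s\in\{-1,0,1\}^n$ whose partial sums $h_k=s_1+\cdots+s_k$ ($0\le k\le n$) are all non-negative and with $h_n=0$; it is drawn as the piecewise linear path through the points $(k,h_k)$, from $(0,0)$ to $(n,0)$. Its area is the area between this path and the $x$-axis, $\mathrm{Area}(s)=\sum_{k=0}^{n-1}\frac{h_k+h_{k+1}}2$. Let $M_r(n)=\sum_{s}\mathrm{Area}(s)^r$, the sum over all Motzkin paths of length $n$ (with $0^0=1$), and let $$M_n=\sum_{k=0}^{\lfloor n/2\rfloor}\frac{n!}{k!\,(k+1)!\,(n-2k)!}$$ be the Motzkin numbers. Then, for all $n\ge 0$, $M_0(n)=M_n$, and for every $1\le r\le 20$ $$M_r(n)=Q_{r,1}(n)\,M_n+Q_{r,2}(n)\,M_{n+1}+Q_{r,3}(n)\,3^n+Q_{r,4}(n)\,(-1)^n ,$$ with explicit polynomials $Q_{r,j}(n)=\frac1{d_{r,j}}\sum_i a_{r,j,i}\,n^i$, where the positive integers $d_{r,j}$ and the integers $a_{r,j,0},a_{r,j,1},\dots$ are listed, for all $1\le r\le 20$ and $1\le j\le 4$, in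 the tables `motzkinTable1`, …, `motzkinTable4` of the formal definitions (entry $r$ of table $j$ is $(d_{r,j},[a_{r,j,0},a_{r,j,1},\dots])$). For $1\le r\le 4$ the formulas read $$M_1(n)=(-n-1)M_n+\tfrac{3^{n+1}}4+\tfrac{(-1)^n}4,$$ $$M_2(n)=\left(\tfrac{25}{36}n^3+\tfrac{11}3n^2+\tfrac{191}{36}n+\tfrac73\right)M_n+\left(-\tfrac5{36}n^3-\tfrac23n^2-\tfrac{31}{36}n-\tfrac13\right)M_{n+1}+\left(-\tfrac{3n}2-\tfrac32\right)3^n+\left(-\tfrac n2-\tfrac12\right)(-1)^n,$$ $$\begin{aligned}M_3(n)={}&\left(-\tfrac{25}{12}n^4-\tfrac{133}{12}n^3-\tfrac{251}{12}n^2-\tfrac{203}{12}n-5\right)M_n+\left(\tfrac5{12}n^4+\tfrac{29}{12}n^3+\tfrac{55}{12}n^2+\tfrac{43}{12}n+1\right)M_{n+1}\\&+\left(\tfrac{15}{64}n^3+\tfrac{207}{64}n^2+\tfrac{1521}{256}n+\tfrac{1503}{512}\right)3^n+\left(\tfrac{15}{64}n^3+\tfrac{93}{64}n^2+\tfrac{585}{256}n+\tfrac{545}{512}\right)(-1)^n,\end{aligned}$$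 $$\begin{aligned}M_4(n)={}&\left(\tfrac{221}{324}n^6+\tfrac{31441}{3780}n^5+\tfrac{411613}{11340}n^4+\tfrac{72251}{945}n^3+\tfrac{34189}{405}n^2+\tfrac{59401}{1260}n+\tfrac{3314}{315}\right)M_n\\&+\left(-\tfrac{221}{1134}n^6-\tfrac{1409}{630}n^5-\tfrac{27248}{2835}n^4-\tfrac{10781}{540}n^3-\tfrac{122653}{5670}n^2-\tfrac{6349}{540}n-\tfrac{794}{315}\right)M_{n+1}\\&+\left(-\tfrac{15}{16}n^4-\tfrac{63}8n^3-\tfrac{1197}{64}n^2-\tfrac{2241}{128}n-\tfrac{735}{128}\right)3^n+\left(-\tfrac{15}{16}n^4-\tfrac{19}4n^3-\tfrac{573}{64}n^2-\tfrac{947}{128}n-\tfrac{289}{128}\right)(-1)^n.\end{aligned}$$ -/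

import Mathlib

/-- The height of the path with step sequence `s` (each step `-1`, `0` or `1`) above the
abscissa `k`, that is, the `k`-th partial sum of `s`. -/
def pathHeight {n : ℕ} (s : Fin n → SignType) (k : ℕ) : ℤ :=
  ∑ i ∈ Finset.univ.filter (fun i : Fin n => (i : ℕ) < k), (s i : ℤ)

/-- The Motzkin paths from `(0,0)` to `(n,0)`: all partial sums are non-negative and the total
sum is zero. -/
def motzkinPaths (n : ℕ) : Finset (Fin n → SignType) :=
  {s | (∀ k ≤ n, 0 ≤ pathHeight s k) ∧ pathHeight s n = 0}

/-- The area under the (piecewise linear) path: one trapezoid for each step. -/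
def pathArea {n : ℕ} (s : Fin n → SignType) : ℚ :=
  ∑ k ∈ Finset.range n, ((pathHeight s k : ℚ) + (pathHeight s (k + 1) : ℚ)) / 2

/-- `M_r(n)`: the sum of the `r`-th powers of the areas under the Motzkin paths of length `n`. -/
def motzkinPowerSum (r n : ℕ) : ℚ :=
  ∑ s ∈ motzkinPaths n, pathArea s ^ r

/-- The Motzkin number `M_n = ∑ k, n! / (k! (k + 1)! (n - 2 k)!)`, written with binomial
coefficients and Catalan numbers. -/
def motzkinNumber (n : ℕ) : ℕ :=
  ∑ k ∈ Finset.range (n / 2 + 1), n.choose (2 * k) * catalan k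

/-- The polynomial `(a₀ + a₁ X + a₂ X² + ⋯) / d`, for `t = (d, [a₀, a₁, a₂, …])`. -/
noncomputable def tablePolynomial (t : ℕ × List ℤ) : Polynomial ℚ :=
  Polynomial.C (1 / (t.1 : ℚ)) *
    t.2.foldr (fun a p => Polynomial.C (a : ℚ) + Polynomial.X * p) 0

/-- Common denominator and numerators (constant term first) of the coefficients of the polynomial
that multiplies `M_n` in the formula for `M_r(n)`, for `r = 1, …, 20`. -/
def motzkinTable1 : ℕ → ℕ × List ℤ
  | 1 => (1,
      [-1, -1])
  | 2 => (36,
      [84, 191, 132, 25])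
  | 3 => (12,
      [-60, -203, -251, -133, -25])
  | 4 => (11340,
      [119304, 534609, 957292, 867012, 411613, 94323, 7735])
  | 5 => (2268,
      [-49752, -277173, -648961, -828904, -625945, -281404, -70558, -7735])
  | 6 => (3891888,
      [177431472, 1176413508, 3391638300, 5582374294, 5764390839, 3855390489, 1660356810,
      439171260, 62927955, 3395825])
  | 7 => (555984,
      [-52643952, -402710796, -1373714376, -2760242746, -3612499165, -3208716096, -1959196587,
      -818475726, -228472719, -39777260, -3395825])
  | 8 => (56568592080,
      [11311884819648, 94980436484220, 374476211373168, 892901840208024, 1413847011517556,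
      1560965091077247, 1233654540884377, 704966334538725, 290353304952975, 84504639343317,
      16450748234179, 1853564053395, 78203923025])
  | 9 => (6285399120,
      [-2754107334720, -23741780253660, -105408077259564, -294414132102648, -551701631902004,
      -727162954010579, -701235471192856, -507451564671838, -277301169482916, -113138837784996,
      -33686358824920, -7109755987654, -1010412737420, -78203923025])
  | 10 => (9367758848448,
      [6257016871336512, 54585240342807888, 374206816449633168, 1277817504193419912,
      2707264778176972476, 4096562252377995896, 4675052112136500450, 4098500613861111035,
      2781805417002003552, 1460456016700115492, 587681734287625776, 179128020771854446,
      40812854288902620, 6681801877951060, 675299729360550, 24578817079375])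
  | 11 => (851614440768,
      [1116528767404992, 11066297516223696, -52095993351953472, -344915452714563000,
      -826795974218050692, -1315617763302919292, -1682709717372457418, -1757897769055059317,
      -1445682288923757851, -924094194166957172, -464011732568809268, -185304736461875854,
      -58481251557775498, -14085823914578968, -2475795514103050, -311361456851725, -24578817079375])
  | 12 => (210540380118868800,
      [-35092780072938721077120, -64396742360793832907280, 147589793840882788384032,
      420293156908461411676752, 590509378951687679481504, 989378065078300067811744,
      1540230519365999885220858, 1865406916716607268759763, 1783565124619974999999077,
      1352588428575668476789212, 817403968723279119073133, 400562811124058087610138,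
      160448532774757528634114, 51541163966176210076364, 12843025979539671080692,
      2450200039445035851387, 361677829005457607065, 36467051043024416400, 1225086777341681125])
  | 13 => (16195413855297600,
      [32968977497087077353600, 75174753933756452091600, -120874032633175279245072,
      -404149724250549836328144, -251498654504142964017696, -20954599710978598364848,
      -262136950141003591919682, -612656788028956609578841, -674584489527478759748700,
      -540821309334040878959109, -372594103731412821879885, -222773909793884603560351,
      -110046178385042893880052, -43368473058333493118278, -13728163304094101916336,
      -3602193742631997034539, -764956658449976611752, -118468460926977491965,
      -13386145610572160025, -1225086777341681125])
  | 14 => (280439786318333241600,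
      [-8346930646444677962317843200, 41282071253353348469357342400,
      102400172328365539707117941568, 8070772067444877211649346336,
      -75597501343939837831276341552, -16641558296760243568607621136,
      32090995076432664400998610320, 41137230206590801237348547216, 49335953437527091587049287000,
      46282899550458765003341917702, 34502853184947558752599563981, 23488505427825142478710640535,
      14033326590369212898555682431, 6731498868820133914678423979, 2575117821160128768706389906,
      828759352018263920640293638, 229867790800464276517897446, 51042493552705201224670380,
      8359454172231839537825025, 1115354104337161242855875, 126731721274092565015875,
      4147703519500467611875])
  | 15 => (18695985754555549440,
      [5722695273393137116815978240, -43807983993688129784680587840,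
      -146847523383928852630197259392, -63310211318790077764823307360,
      153089673035382797350834892304, 133297377668541315286127893440,
      -33049723623221022627398466672, -65700579608985394026315975992,
      -18771971560292590841784054344, -3410423253297634332169833262,
      -8422107095714208226877263579, -9576113864643989545939712916, -6535914768751570952435137374,
      -3326484804850891189685329826, -1448962363430310412616731133, -590745009852787344240950992,
      -206296123366630283670318556, -54775090562181926644752402, -11893824587759718577429749,
      -2412631748473022800739780, -355208270203091264173550, -31882612490166464278750,
      -4147703519500467611875])
  | 16 => (4449738089512993544467200,
      [170091257320000019382283129328363520, 694102771295714735921483306706231360,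
      -65488488466914723163202793888846336, -1347239340788641325458681875588852480,
      -512967322159804340391856840777111104, 491679102846614776223502868299230256,
      208493918022160220437387272507063264, -40441581739287911264845115802683160,
      16450094809155043787360301509942920, 16873985268140083433060400548483280,
      114131068871026769196761533768972, 8135348456321402539882721854270818,
      10582528729896099930270086285404447, 5872251905080637976970358404226832,
      2479113488923996607607437971096798, 1152273664746607374002841775228554,
      519220833456918144094267099013797, 175454602750403662334940892524432,
      44219972580159855000626761890112, 10460322709973146674393254203878,
      2373645657679199535366447683305, 351548501790945626554509304800,
      35562117138339295090178185750, 5632230796776445780249263750, 188782732379486470144976875])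
  | 17 => (261749299383117267321600,
      [-176693829202292912340581514678220800, -819091800864991892534860894480372800,
      -331622251929230372294779642165724736, 1913173781686998409392657649538943744,
      1968226524864417737649407640019375680, -517997952484847483077105630642028016,
      -1217738447133504623081147549135297808, -154059855069600729919423800475327944,
      264653470991538004288686636611415056, 70407308792621504020802654513451464,
      -25213072494841120893634995501767884, -13200148012932723483835603481822446,
      -3323844547856865263758454737376017, -1294685842716932308045311575197135,
      -658159202105309979413901910366174, -542718073624479931641070866415912,
      -319949635403663376489071138239039, -103586021915700769896359504068693,
      -27839023170781779151388653519648, -10121796850251227070787372143142,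
      -2728748239904924794866048717055, -416109426926147501624411592745,
      -82695791335394251856809898950, -15326495798667320397831377500,
      -556084589642818682584590625, -188782732379486470144976875])
  | 18 => (122972961841781089594895539200,
      [6226847096604692161492732663983456500659200, -4693900288129121056567657101952508432812800,
      -42652296369476607320673065987662620474815232,
      -22332049153344095925510712447079404850688384, 30795518552638506334955974481427005254884288,
      19371406424584582870102641252785958901366272, -6729954349546592699664183214385863875587616,
      -4117853264696072302609042449425501894178480, 982911259423953495122428086993199405001664,
      176345600719237991645973278505769282653184, -236101114917708213746270507910479610932376,
      31706322657562056502859303959588668250908, 56970703884613324945201366340933125162164,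
      4669107188102855804083109308323904170225, -3712202924049222509772982475106919236792,
      952346576864837533967215931032795364685, 1569187869827822671411122206716935924228,
      560343134666146953368559556238174823285, 111693651063198449577681567410614275336,
      43398371379222711041208289290842752521, 20476528425910290419342878537421455356,
      4544432425419561433654253991120974259, 590548809915486276114144396012466680,
      175238123671010446227794941128105975, 32939079485915535800768833949383500,
      934157625834407704816060021134375, 460478782898108606953591743510000,
      16679562661563058086230420234375])
  | 19 => (6472261149567425768152396800,
      [-5725206655850507090219822336770305264153600, 1752859365132574039681311728151026575238400,
      53178697477562662909257355731982694578698240, 63125480075087236677390207448332182182311552,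
      -24641908394539955490514949962687016275022400,
      -65257677855453220843472914125062012584124736,
      -10952575188587763988214529736952029202530656, 20506369870463778831604558470657285589262352,
      6819319423236583449424011364116378802216560, -2763670487846120986143327411696908037992896,
      -1246327394031098650822745197421740980938056, 169066372706215286911779765076387707068172,
      95731473796841134252268075701378158189480, -6512501464338344851679125069865494877661,
      -955179884864509532303578061310672011361, -43856512878246744133780714036612949613,
      -1203249974239167649559417021520779577465, -242066899134311373182534159287377080721,
      44292953721224627867967231013453698939, -30627730932552070059723263075950926633,
      -20053333507921208861545491079668954525, -1816479719267464753540278292124951511,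
      -352188869682827568511960171447040931, -300420681813767806830445883220742455,
      -28223748201616110579763626140612475, -1450228596732338296779559454506875,
      -1731028566497471050037783856159375, 54996012828356120030689089840625,
      -16679562661563058086230420234375])
  | 20 => (645239130783825377104416894182400,
      [-24935871251002690007396284534169649540100665845760,
      -262233558924993470380778968817028786065947060542720,
      -189018868443216845020943046333717275149942584359424,
      386293870925909277945211942740032041040654000865024,
      347726502706343403100504773992212201122515453105664,
      -123120466818908554961059326893944156359332112938112,
      -139915843996546361200812511051081978643738011741344,
      15456606205303848350722343419348993423577872532304,
      22214428410694224919432150021093776690537850439472,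
      -2604879719830722719908183097183980869823663310928,
      -1891649121416151601269536768080565491047095821120,
      611278710180183575884626652682472934855450515948,
      172718984014846230568521984267799472355541754512,
      -77059502149979464936787724033504674227140552213,
      -23904493665243990627701574735422121540296464914,
      4460893312833707667672344154136584370667342244,
      3163632248580526874888637028788338003257801149,
      250221160790718185250712575282158722571585364,
      -212902155418013829697191010891800409991128791,
      -13268638218019694977228658564078230058937468, 32398872088366499066524916365501191901531833,
      6525717109019840674794539217949216572018618, -602742366787254733254903517798347300790287,
      225500947552579468741646954962478951705868, 154624520107194152086785891298903892577975,
      2811576962670433156325732824565231605236, 309801294045326918184405981725071086075,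
      942973485549022256574001752801853674000, -36731808049798283088821499011051598125,
      7368990619320497468506392330957451875, 308647616940380797241614918122468125])
  | _ => (1, [])

/-- Common denominator and numerators (constant term first) of the coefficients of the polynomial
that multiplies `M_{n+1}` in the formula for `M_r(n)`, for `r = 1, …, 20`. -/
def motzkinTable2 : ℕ → ℕ × List ℤ
  | 1 => (1,
      [])
  | 2 => (36,
      [-12, -31, -24, -5])
  | 3 => (12,
      [12, 43, 55, 29, 5])
  | 4 => (11340,
      [-28584, -133329, -245306, -226401, -108992, -25362, -2210])
  | 5 => (2268,
      [13464, 77493, 185855, 242387, 186713, 85214, 21272, 2210])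
  | 6 => (3891888,
      [-52891056, -357726852, -1053222420, -1770533582, -1862780337, -1262929833, -546758514,
      -143459040, -20073705, -1076725])
  | 7 => (555984,
      [17060976, 130947660, 453568848, 930218642, 1240104815, 1115028354, 684812595, 286545714,
      79682121, 13565710, 1076725])
  | 8 => (56568592080,
      [-4071105033408, -32170625924220, -129495380276088, -316463010698532, -508990759509064,
      -567613059397665, -451569976519898, -258995477048175, -106671505469640, -30805670852007,
      -5851679094506, -628202612505, -25640630500])
  | 9 => (6285399120,
      [1145045160000, 8206610213340, 37249065942516, 108726753716748, 207359062256932,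
      274447175611897, 265777855902635, 193513817606681, 106038699182583, 43042121761983,
      12657221342369, 2626536461891, 361706216005, 25640630500])
  | 10 => (9367758848448,
      [-1460724340931136, -11516121977038416, -137865819193095024, -498823107045229512,
      -1051410207470751348, -1592380938101728360, -1826565807088755210, -1610065885718755243,
      -1096543483876563156, -574625975811142096, -229433529976916412, -69145764483056954,
      -15514057050221760, -2461185504230840, -233497690157250, -8148046209875])
  | 11 => (851614440768,
      [-1988581954751424, -13422609351625680, 16191470266165728, 152740476142079544,
      339836738282546172, 516539375679954196, 668838953355944650, 711075221835596149,
      585917262589995487, 372525701549677876, 186245244719936284, 74077469935089110,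
      23106705792216410, 5439270982103312, 933228758654450, 114263084043125, 8148046209875])
  | 12 => (210540380118868800,
      [35523966771422164379520, 34433512662231205451280, -105732624849279007396032,
      -195335937399786730439904, -223383597527428265303712, -393018590685811022995992,
      -628227851385019853358126, -769690615990700915848635, -739696446003357299736241,
      -558170474250113859708651, -335364740179522059031762, -163991093455119028859178,
      -65338473448457525161102, -20664151860827452683882, -5039003492600035195550,
      -945013557126752542203, -135876572484858457385, -12689765182375757475, -407615710194124250])
  | 13 => (16195413855297600,
      [-33035313912238376323200, -48314517101700317384400, 107586892049543843898672,
      230152479486512643225216, 67985339493115157668176, -42634040616382416389176,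
      116387876534589822085038, 274882965156565472219381, 284442890311686287962656,
      223732879540298395638432, 155688662877036733443153, 93693771781460677033460,
      45848522832487110460080, 17772525024688787836784, 5570943442595571705912,
      1447869540608478120693, 298137129989876877288, 44650109039737847360, 5039777995624494225,
      407615710194124250])
  | 14 => (280439786318333241600,
      [8349228009174197748233030400, -33109195977908417436871838400,
      -58306740638844173547536676288, 14880469423763950913651013216,
      41501795828650577498209123152, 2638147439300989842106113168, -14272946463541610021100466128,
      -17944687910850046449055573360, -21903358760063112815484696648,
      -19426355008709670314066811506, -14413218931273021011222717855,
      -10062457747454104472801485203, -5999828341052932914722150385,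
      -2819670434712212945292011167, -1064310023101370139026824854, -341952235148570746005944078,
      -93536855343271482960896394, -20039424368015750800599120, -3212082547901271829692075,
      -429214631617191671677375, -44214500164198978276125, -1381725067605611429375])
  | 15 => (18695985754555549440,
      [-5723001588423739754938003200, 33543407115377000785767620160, 91705407929535061964502968832,
      10208505405280995792069453792, -103088068120151057778775365168,
      -54385935583715566142127585696, 30510979425206778297000177744,
      29567349482906444990757291640, 4873261570099151204313407320, 828073813682802185594590514,
      3938156175475112938930049897, 4303219717476954232869776034, 2811703395122014316547126204,
      1391995336649725230851050480, 613067319901452525680849461, 252257293401842533469114684,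
      85391207749920686455226024, 22022763973004167501631442, 4829947022921902351997331,
      951161900429198640060970, 130521285871505510451700, 12657614922437797311500,
      1381725067605611429375])
  | 16 => (2224869044756496772233600,
      [-85045555755491151110255332113576960, -213053612064920020551450970001256480,
      120594984485705884301957977680767808, 394718172036127784967715005145251168,
      44649115192549935235601135648217216, -141495743692502213258468667111800904,
      -27602910738834869900269166583813768, 9030396549537176465627941711138140,
      -6354119127669841153945230563056660, -1841313690955845534049508067325860,
      413275525184185266003098815447064, -2243101179015082410313436837953605,
      -2401254545695548865530716411841028, -1208800769207694314153213435559378,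
      -518101080518178975151183500859216, -253632701761713055014821106548367,
      -111771802023135791327353294630648, -35923733762347819431695935095768,
      -8990154682387443436485013109128, -2177918530506976368647287855851,
      -468006441313663454024719783060, -65130578877241340357806619850,
      -7241207686528819967093539000, -985012163851831813932688125, -31457394950452937516537500])
  | 17 => (130874649691558633660800,
      [88346906024145413984304141744921600, 282323364146209865935478505554733600,
      -7152046611881942423177341665975072, -656184537914834833329330399989483424,
      -430720884761169446351517059760951648, 272129603807344949325169700264157384,
      287671739817560312929609399340777040, -11760780319107616046239909010629716,
      -65237869198823644382837178212253320, -9094439815001721713185095906081656,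
      6607484085445639553333142838928308, 2596706663478658252102788404015773,
      664356998553866193914479872450769, 235459001736232812198151875930790,
      144270745789732568051276984742442, 130817011361929880433664329466063,
      68433988162349661226057016983279, 20533140661614433911493500812992,
      6065070853557174552757191097432, 2189266822029781313771929830979,
      527466105342201705475369801495, 83517988861744701694138602190,
      17393733609845241681130610650, 2619873717821754818696741125, 139516292894355289453500625,
      31457394950452937516537500])
  | 18 => (122972961841781089594895539200,
      [-6226847080486380106966801688601308386636800, 6195823363700381508749402173410081519532800,
      27836556003162963627217025943473836293088512, 4530570181026007362638266197800616191527296,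
      -19846651678590594515826772119273317570081088, -6139580661911747214700460930208408099828480,
      4486435843192211162911089466779277650844320, 1187673190816298823586847856617926308274608,
      -539947284487618068611466145884171150205440, 38272663978852922839470222391092986704864,
      92645209711501874096130985897226096901576, -32091074711836231828019769383803451524332,
      -22894238385918596556350426369671519264164, 387058338077598648155420220795526844991,
      1578828429995943146456897318210953006620, -704761699097443877955362038083342816369,
      -708336887644883304752461695659810634300, -213683613653034323310165816013075423629,
      -44839275274864798102083653491627414908, -20961964633877360819265665634276926853,
      -8607034369671149969786086598797534908, -1688372759867979249522986857446921171,
      -257221440087481832910206055886508220, -74195629041491784026897678093416275,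
      -11109098373843740041074095045662500, -528143103704905062961573895349375,
      -161774515235699273580385668967500, -5559477600421407438665319746875])
  | 19 => (6472261149567425768152396800,
      [5725206654153842663427619076203763357414400, -2545298206066759940423103234515740662355200,
      -37526313725300401204116456607713620417994240,
      -29776025675009899365156370400814628462058112, 25594566028359357704907370930179565325243328,
      32926390428364771512831736686702216982476480, -1170964032270796507377438041148103492810656,
      -10821872083841645719037290072049431636080912, -1753718216333096888965649081306574987233712,
      1556030535666522170004627362468494823132000, 398428348243676323656733484573651135396504,
      -105905182789620663621681530415602600004492, -30550824276943628069714972483630940621312,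
      3227650820125395944667467468970908749365, -207869058565118727612864524639844673131,
      364543530188288687071576357455895059813, 539027604718114762356466153076735734173,
      48614121792348415006569387182197356825, -13546453076554179839099046530329823751,
      18219285651617352702220671379084314033, 7436430221747090672104755874982534673,
      570442073022685670516842335725280255, 239816489866726445560918566767672799,
      114298101941285089477791939945719295, 8748021953572629322447131043400775,
      1395192687269520964682485737889875, 537470599128684253382680082806875,
      -10014746801425664747183202685625, 5559477600421407438665319746875])
  | 20 => (645239130783825377104416894182400,
      [24935871251340981140796674773480970064717767976960,
      179749520502955203842697577763518661012022310821120,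
      53423213974719673607694101660613177758695408687104,
      -273231573305064870837646590320490159711546977218560,
      -131266262594924372542753994277656751279880782652416,
      100261367865411835245673434742834158745351479520512,
      52934447398923462335460213187051279373221311152736,
      -15653225073555753789879984109942512312531277423824,
      -7644486892941848999986943858675377481968120730736,
      1990069264666844684668962453530157415140181861824,
      481814650620892696241300976985344849583943107376,
      -316814907431461491546954056106481721774735662380,
      -36017988959414565652140158532266786325258344456,
      38238357871651651112400429820890717589138982649,
      7446788693734641782603128422675923727461314980,
      -2731983366476486271400815796067676531367171467,
      -1265687748052644141028764342059386339155098742,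
      -1883676209030074294918166921513698314078687, 94127207221593762523351476862259326645492098,
      -5932063794165943404397215153198265689980655, -14231593568534630667757238313959593603034574,
      -1815513457029460256446924520965049024843889, 201559715751695124136206538484339662436946,
      -146761523412400802460783796941385831337649, -53475953374091195818244197156142751380946,
      -350555140991402823623567591918483069589, -603262240133571691695094520498349631050,
      -290932048186762302625119013903710521625, 8785744795532827086655146128845348750,
      -2610261127884488471136005883665092500, -102880215893465381012051378989858750])
  | _ => (1, [])

/-- Common denominator and numerators (constant term first) of the coefficients of the polynomial
that multiplies `3^n` in the formula for `M_r(n)`, for `r = 1, …, 20`. -/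
def motzkinTable3 : ℕ → ℕ × List ℤ
  | 1 => (4,
      [3])
  | 2 => (2,
      [-3, -3])
  | 3 => (512,
      [1503, 3042, 1656, 120])
  | 4 => (128,
      [-735, -2241, -2394, -1008, -120])
  | 5 => (393216,
      [4428117, 17987130, 28551940, 21922560, 8105920, 1192800, 36160])
  | 6 => (65536,
      [-1451349, -7347087, -15435070, -17189380, -10767040, -3695392, -614560, -36160])
  | 7 => (226492416,
      [9936155709, 59703505758, 156096487872, 227408790520, 201148511760, 109840502688,
      36000066816, 6505893120, 537120000, 10073600])
  | 8 => (28311552,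
      [-2489827005, -17084113947, -53288193438, -95994268984, -109601668360, -82357163952,
      -40784841888, -12978375168, -2494917120, -255599360, -10073600])
  | 9 => (2551210573824,
      [458043992605683, 3451132513413918, 12493939585613796, 26795620856608560, 37509419921070416,
      35900182406850432, 23884574509269760, 11005691967553536, 3435496431780864, 693359666588160,
      82826639678464, 4838793498624, 66132316160])
  | 10 => (1275605286912,
      [-479520114111423, -3797614448741205, -15623060983412490, -38986012362126180,
      -64626421957694080, -75183155432113168, -62890143642719360, -38092021084409600,
      -16620618543682560, -5123480156382720, -1076375034437120, -144434476129280, -10908345425920,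
      -330661580800])
  | 11 => (24313500625010688,
      [-34924672069741995723, 219852351104180181030, 674726498646718559256, 2079901395735944116680,
      3939218428890746994720, 5412154925052961478848, 5452984911441675928320,
      4101387111651736466560, 2306963377850619671040, 964885427884176747520,
      295104597309213339648, 64147507283122565120, 9433653833937715200, 858523737559040000,
      39858237299097600, 432860205056000])
  | 12 => (2026125052084224,
      [50990712120653977035, -36370292074202852955, -159013614229835016510, -433963177603583168736,
      -1009984471033428117480, -1565651759776298722528, -1858550027549923244992,
      -1667989421280206088064, -1151586458102522865280, -610294483086972935680,
      -246867333956491156480, -75166386061570678784, -16827405509078528000, -2666453359982182400,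
      -280123942931824640, -17181820945203200, -432860205056000])
  | 13 => (73254707113878355968,
      [-56760011295329813858861229, 44402381876006237733319782, -11899367327517524149504212,
      52327574641747541852132832, 100566267150052960964384544, 187447865257914150804039648,
      251743176197131030810233152, 264044582467643380984229376, 215927406934550747785400064,
      138875178621660879363863040, 70103508383011474373882880, 27613136777111398707757056,
      8389205358825016480661504, 1927468985704349495869440, 325071423613009464360960,
      38287810161482483367936, 2878936983074608447488, 113833920273369661440, 1034898222527283200])
  | 14 => (5232479079562739712,
      [48450052373483616478065837, -1324193042792363731730361, -23626014188424977192019858,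
      9712234579953695436795636, -28766109986108973707482368, -39087892324252852343504640,
      -63646234718297588953420064, -75764040118157210670577472, -71568718503100020091698432,
      -54267498538001477190189312, -32864385397820755109979648, -15939997319521840827085824,
      -6145745664598970166444032, -1865812498110662039355392, -438820176089264626974720,
      -78026328836076133908480, -10092653735164104081408, -889341819536810508288,
      -47051744449363312640, -1034898222527283200])
  | 15 => (56259615063458577383424,
      [5586917361163964958588067363941, -13779179109408457285305475612482,
      10767623069933635809895760995632, -4935097747128482278968068211240,
      2578605175864942177641345005040, 698044579288660948449694621536,
      2457124121692209283874932958208, 2991575056849157879665262709760,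
      3296473704324098935432293550080, 2850191399075668262219312291840,
      2024924355003130033117339164672, 1166188801576460691936814602240,
      546929387903377371408810577920, 207251909515539930976190341120,
      62948300769706285439674613760, 15121053027014856571020247040, 2814008276747433138150113280,
      393733429562666285481984000, 39411235551274742395699200, 2578628214133282137702400,
      90979984314568409088000, 716742061901742080000])
  | 16 => (3516225941466161086464,
      [-8101152864207100817378914707045, 3392990323492040868363954516189,
      2191783885369478462545344165906, -3959612201198965097595920253192,
      2771540073388574559678619009080, -1781157575507425241724298853712,
      200762638273546396511613811872, -900197013374739376824887898112,
      -749609925555076835662469862400, -813533747825850859173265172480,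
      -647438332309900307051368939520, -434410635872366008444179462144,
      -240185040130084138900871424000, -109355152065665100462763356160,
      -40874850588657455672662958080, -12431327661424873773646217216,
      -3043344698013711698818826240, -589537087659524837335695360, -88185877688627247142010880,
      -9801892351501177645957120, -758003340112274980864000, -36060597933403406336000,
      -716742061901742080000])
  | 17 => (73305139997828771639388536832,
      [33419090833472643299422557371024088362139, -34218341631431388149005706419494447657858,
      20397819694171342156974402262453399918932, -8774840160516210923991358303526734405488,
      3068209744734098213297178224639527620144, -900992166749864081118532087781084230464,
      274165566707356024654115433956127636864, -13598257461588668009243856339198767616,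
      77931527722631037797600583434490115328, 66349076222673871093114466103843452928,
      64135377547355819488877948381311668224, 48484676596111246080396669045242019840,
      30853937715138631241332297738196172800, 16481558969213113230140474652164947968,
      7314707671253762899219604591081553920, 2703911103295133784260541336470421504,
      823971223845337872141124171580309504, 205209294433963981442000015352004608,
      41195185707591943589321590255124480, 6526957727820174067566675414220800,
      792311503805401989958121374613504, 70164552831329866711088221913088,
      4140110946362604403215313141760, 134940952689369304696199577600, 944106887861874735448064000])
  | 18 => (4072507777657153979966029824,
      [-32403562245993769261763476467196797439131, 2539376963570018511367053048977979533031,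
      14010499830722055235768935489813969844782, -11977121789521699079179921846877798832612,
      5982895748563675006551167208813306696000, -2204145378213216780051844549500858604272,
      624509830108379398781785757293440497088, -141155062930051119644581046169500650368,
      1759837946815899321364801687049665792, -12037542052548479106197010831853874432,
      -17713349941808165363160530683027490816, -12479550696214100495335386810712936448,
      -9692399700430998868126804344461361152, -5802780025201148164160148806313328640,
      -3008587357033468572703290824056045568, -1309161245307911562565339213159596032,
      -478827505858785948200538051935731712, -146345528156473066324890778007896064,
      -37027879188570050230719837023633408, -7670933582776294455360208386129920,
      -1278418143302519928049781354528768, -167332848581798990337289915203584,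
      -16563388627066908540257863467008, -1160155017867308415944134492160,
      -51211423023011474819357081600, -944106887861874735448064000])
  | 19 => (57779882979341246530078038294528,
      [12626351575690178787945165915136082020799024067,
      -4396204519987736850724544154046053721828237638,
      -171700364512181426114847130066157033011779720,
      854957002649244737414169815401152650888407896,
      -561661826265373262095641939087753532240835328,
      260356712369352739709355604814241980306722176,
      -100418992831785021476220419327268173285967360,
      34436328874129686019508081496399205531423872, -9944602155486601088958643805549524961434368,
      3942629545719326923215833958799178677530112, -26844943150133280719187536076586542618624,
      1113819132673105595126812635889426509477888, 625938481880626044562345304712050018844672,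
      486436155057997200937624831175095879532544, 278276611433826912749192095778632866988032,
      140106324478395384782540836850920252637184, 60059327208257240350965257594086335578112,
      21746004213141529216589126817001331490816, 6670923320282059403644456205052690825216,
      1712757186186372153414635344881836359680, 364842163252070216650149227014108741632,
      63610250708731737976830866886091603968, 8885326074294704396179116679841710080,
      965725600162250553639491001982648320, 77893397165365493718081829286707200,
      4254288246936128149782892904448000, 131753575889477605653177434112000,
      833902428870866909360291840000])
  | 20 => (14444970744835311632519509573632,
      [-48666969218806352062597197379541006108290752975,
      -13527032122717865258320093857367751291452718961,
      28369815092798510390778190984499934299344381446,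
      -11958217886547394004490700696145470922502497040,
      319603689903953180082563626044013643582235720,
      2491204084112722251844831414531735542992476032,
      -1797998264785038642863962348428432007184237952,
      823533161175255637127770414375124279643981696,
      -290951102461222240697488494135292958516584320,
      81664373562113601196514707564238463651815680, -19450998453062810887594290981370084896550400,
      2195981880678788213499485194503683318882304, -1110180442665641077791874230155315032135680,
      -646951828502410288415544209743744988774400, -398005947993200160299314312677487618621440,
      -239059095573377165353910893600721396170752, -114779055905933564835019021607754344693760,
      -48610767835791443335766234926040892702720, -17498933886876778190636662701562610319360,
      -5378727901753406352627256228061537894400, -1400584476184661508177583496135552532480,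
      -306001926685771895825426405807011921920, -55513986488720988128932100968336588800,
      -8211085703788952656181620140964577280, -967290700194149679521287263706152960,
      -87549944093305298794608531288883200, -5682038579408232985697370243072000,
      -238769049013159281670582435840000, -4169512144354334546801459200000])
  | _ => (1, [])

/-- Common denominator and numerators (constant term first) of the coefficients of the polynomial
that multiplies `(-1)^n` in the formula for `M_r(n)`, for `r = 1, …, 20`. -/
def motzkinTable4 : ℕ → ℕ × List ℤ
  | 1 => (4,
      [1])
  | 2 => (2,
      [-1, -1])
  | 3 => (512,
      [545, 1170, 744, 120])
  | 4 => (128,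
      [-289, -947, -1146, -608, -120])
  | 5 => (131072,
      [621113, 2730390, 4840260, 4356480, 2061440, 469920, 36160])
  | 6 => (65536,
      [-645803, -3557229, -8288910, -10515020, -7856640, -3514464, -903840, -108480])
  | 7 => (25165824,
      [506595435, 3400559118, 9788278656, 15927043960, 16270422000, 10831646112, 4700166912,
      1278024960, 191128320, 10073600])
  | 8 => (3145728,
      [-126005739, -1022347257, -3517411086, -6941623672, -8930218600, -7905436560, -4858173600,
      -2043488256, -575016960, -104003840, -10073600])
  | 9 => (94489280512,
      [7224663492343, 76953806076978, 288197064804420, 660026616288336, 1034430125157968,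
      1140141483879552, 902616443263744, 516894375849984, 213190309466112, 62734697203200,
      12753439046656, 1560025313280, 66132316160])
  | 10 => (47244640256,
      [-6429251584723, -107480181026765, -401945431782990, -958641622216420, -1773936316583200,
      -2406472539244048, -2334380535653760, -1668687846045440, -906104927354880, -374327256624640,
      -113940159449600, -24388542602240, -3592026931200, -330661580800])
  | 11 => (300166674382848,
      [738539465552505435, 3171484574179472502, 4105152425579816520, 15404447596477170120,
      37816171620615737440, 58350042888566822848, 66548989225822847744, 57657785895162893440,
      38670257296170339840, 20384900112920611840, 8339959863876472832, 2570227134666813440,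
      587582368745881600, 100453830815744000, 11554638279475200, 432860205056000])
  | 12 => (25013889531904,
      [-680743410213857627, -2302583175476837841, 462115181286956610, 1254834869026649840,
      -9614120772972339240, -20299978447151705120, -22967572439135886016, -21892909634994349952,
      -18126270765463020160, -11942357147833981440, -6039817587889626112, -2378507093424996352,
      -754310821769523200, -189437861799854080, -34069421590937600, -4284406298214400,
      -432860205056000])
  | 13 => (301459700057112576,
      [234815072327852920184799, -291826663600282380888822, -882708264028159128591444,
      329974890686037145239456, 762993291073661051128800, 717497557919464429623072,
      1033830436704160354010432, 1146135877291680358347264, 1061888687590513957294848,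
      843958579027071435333120, 523350471673522151273472, 251498276689467259944960,
      98924568815908628529152, 32607647200920824954880, 8460300177356559974400,
      1599707769905648762880, 237147364695473848320, 29251495021894041600, 1034898222527283200])
  | 14 => (21532835718365184,
      [-199559328568326726097887, 235127362432733353631511, 1343868447892117435304778,
      296220786442483095582900, -1347772705949391679210368, -651155205056970796131072,
      136323551436423894614944, -134205476385546068473664, -397347686957329430709504,
      -354368544775276878442752, -224909324731640719053312, -123585480823929866007552,
      -62025634146723673407488, -25987527049742960082944, -8194907295348122664960,
      -2060074381184160989184, -467821373311581880320, -77895899769371688960,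
      -7680701895576780800, -1034898222527283200])
  | 15 => (77173683214620819456,
      [-7662545409644396780872726125, -103386250848202533202818350034,
      18570353088032047935719689680, 121473332824780913147267359320,
      -5116986552286592081556875760, -26110861351264503294943656096, 6227110854805111114941189120,
      2140495898907579099588029440, 3088063886516889799676129280, 6920238138127341201793126400,
      5042781046910139267860815872, 2637571480854644737011947520, 1522091073619464395990691840,
      821909444043404913737605120, 328668771307826573469941760, 98449423562134170087587840,
      26643220036217624579604480, 6648251360404997278924800, 1114628378205901160448000,
      126265536601883607040000, 20292272571565080576000, 716742061901742080000])
  | 16 => (4823355200913801216,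
      [11112534491790741912499908717, 113113905477576858049313922111,
      54010862487689598237564639234, -198129086630642537642213173800,
      -123377003397385741748503192680, 88548189397257610014395951760,
      58425532980267292222406192288, -14631906092528573995930040320,
      -12772763176117817115744148480, -1569070925131565348258119680, -357226932089182051373871104,
      -648846143071982336197097472, -668702288591771200815892480, -444833903625187577514496000,
      -175230637427548961161093120, -57398436000593436138799104, -23018765966204544628490240,
      -7024228508368343972904960, -1270373579162170900480000, -265227515734521767526400,
      -52847676703593791488000, -2463638485777907712000, -716742061901742080000])
  | 17 => (33518582532157645925646336,
      [-15280789222380881756614622410634174001, -3768902264946650323031739925123032558,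
      61196940056292476246724366712719235188, 7017860430575703544536106794661149936,
      -35090746154955669277771139104223599440, -1249576927022625280488471260112437952,
      6288756190893035523745793603399080320, -1048954034494581003230540972829007360,
      -341052603857477300655346508633946880, 531936563493162703439420017446799360,
      65240807712459558743563089079734272, -58889533745720021378706281461530624,
      15612380318165583345346523127037952, 28334699872512340998230581069414400,
      11326702479626924500466160268083200, 2969961872083544703226915342778368,
      1361204453209925582452645343264768, 657978772661736456013718454927360,
      168145202435932340229198550138880, 27743870091077628724094566400000,
      7981715138118062308916980613120, 1587179722107003893958207078400,
      68171197724451966321636147200, 25342894295596107068080128000, 944106887861874735448064000])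
  | 18 => (1862143474008758106980352,
      [14816443398354837598850018292221918769, 13653349190600279942210594366093665311,
      -68705870374161199926584393571578335878, -68178740862095243979948075025225643364,
      47614621421879935682353214566996434528, 50448398710397603956130570864952696336,
      -10632409642775646987094331265623004864, -13705788163780513110294836373491612544,
      734578292230793539788154437921446144, 1709283123911770776573547941921452800,
      10943341976346132207740603015800832, -87040569873692232891369416220692480,
      -8231369890230908150492446128996352, -14227270185456908512583199012306944,
      -4072994136364636595523246825472000, 431104639538334252626136756256768,
      -822734946527648998625205330903040, -552991475872755386950124121227264,
      -73816094986691472239152745021440, -17143642472709905448884134215680,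
      -11820489294972924083430070681600, -1446261664798666371475193200640,
      -108704020662258944192492339200, -86108984771964081620280934400,
      1937544334615253067235328000, -944106887861874735448064000])
  | 19 => (8806566526343735182148763648,
      [-1924455351401239009938840753658787494302435, 16968182041237241413355101046935206675324714,
      9255725935735711892099328086048016709151592, -22078516910104462624103726127435788499378600,
      -6042420091157527268964922948150016918927232, 7788405290691929113639777203061784632978560,
      1018863440153305432649071340163746110193664, -1226099555632649122953622372005034604469120,
      56056117023705943329899847683403583851264, 132933375106171560588563174460309618400768,
      -33515802756043818271450098223235352643584, -16235781235591792126808132030303826462720,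
      3854962798666370412219081727720156200960, 2308076751662057608855026257657914785792,
      19729274019001953988628765906839535616, -183488023757321717564832143062422650880,
      6408335218254240888265578131667419136, 36101060752610020704393976725262565376,
      7734403699292361595105396604066070528, -301658950843210712774276397174620160,
      462563022868786816575274039463903232, 263390449085238293230338889419325440,
      11554161990097358318313557458944000, 1856270250776689567790277014323200,
      2072682027144813528993005096140800, -64073171124165499153733910528000,
      19901468678344901561482739712000, 833902428870866909360291840000])
  | 20 => (2201641631585933795537190912,
      [7417614572661641097504798279888830585726319, -81510220967335105742892072702168330890479203,
      -126464137114238741254534552616667686662481370,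
      93678044109974391355588733190637499241261120, 163892121177092910267047610976043709564148680,
      -21974113634801639855764991736395130290853120,
      -65949374258245482246870684335110665456524928, -1073670295969212954533323481576406159181440,
      12170616765776659672308792321396288566497920, 874047453865417366747725545227414404739840,
      -1242361154701984545892944640325368864288256, -91149472755343927934948429719235260231680,
      80741821748425811456257596911029782865920, -3347506615824641843487553986611072040960,
      -4189054920956796412294265745376321536000, 1797778481861338071080806395996384657408,
      78077940681830638971027118401261404160, -292078827969605011229326390893106298880,
      6075815398363080520484025151951994880, 17385733944215427844226601530205143040,
      -5663332682353840245134594681733120000, -1234467674157772116388859078403686400,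
      251029355890240727524894250002022400, -57672677608920220737503694422016000,
      -13965231764049874080802846801920000, 2376035265751801750719075188736000,
      -631910819627818121475611688960000, 37712591990115518026486906880000,
      -4169512144354334546801459200000])
  | _ => (1, [])

/-- The polynomial that multiplies `M_n` in the formula for `M_r(n)`, `1 ≤ r ≤ 20`. -/
noncomputable def motzkinQ1 (r : ℕ) : Polynomial ℚ := tablePolynomial (motzkinTable1 r)

/-- The polynomial that multiplies `M_{n+1}` in the formula for `M_r(n)`, `1 ≤ r ≤ 20`. -/
noncomputable def motzkinQ2 (r : ℕ) : Polynomial ℚ := tablePolynomial (motzkinTable2 r)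

/-- The polynomial that multiplies `3^n` in the formula for `M_r(n)`, `1 ≤ r ≤ 20`. -/
noncomputable def motzkinQ3 (r : ℕ) : Polynomial ℚ := tablePolynomial (motzkinTable3 r)

/-- The polynomial that multiplies `(-1)^n` in the formula for `M_r(n)`, `1 ≤ r ≤ 20`. -/
noncomputable def motzkinQ4 (r : ℕ) : Polynomial ℚ := tablePolynomial (motzkinTable4 r)

/-!
Let `A_n(q) = ∑ q ^ area`, summed over the Motzkin paths of length `n`. Cutting a path at its first
return to the axis gives `A_{n+1} = A_n + ∑_{k<n} q ^ (k+1) A_k A_{n-1-k}` (`sum_pow_latticeArea`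
together with `areaGF_succ`); at `q = 1` the Motzkin numbers satisfy the same recurrence
(`areaGF_one_eq_motzkinNumber`). At `q = exp t` the coefficient of `t ^ r` is `M_r(n) / r!`, so that
the series `F_r = ∑ M_r(n) / r! z ^ n` satisfy (`momentSeries_eq`)
`F_r = [r = 0] + z F_r + z² ∑_{i+j=r} H_i F_j`, with `H_i = ∑_{k+j=i} E ^ k F_j / k!` and
`E = d/dz ∘ z`.

Put `w = F_0` and `u = z w`. Then `w = 1 + u + u²`, that is `z = u / (1 + u + u²)`: the series `u`
uniformises the quadratic equation of `w`. With `D = 1 - u²`, the derivation `z d/dz` maps `u` to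
`u w / D`, and `1 - z - 2 z² w`, the factor of `F_r` in the recurrence, equals `D / w`. By induction
`D ^ (3 r - 1) F_r` is `w` times a polynomial in `u` of degree at most `2 (3 r - 1)`
(`hasRationalForm_momentSeries`). The generating function of the claimed closed form has the same
shape: `∑ M_n z ^ n = w`, `∑ M_{n+1} z ^ n = w (1 + u)`, `∑ 3 ^ n z ^ n = w / (1 - u)²`,
`∑ (-1) ^ n z ^ n = w / (1 + u)²`, and multiplying the `n`-th coefficient by `n` costs a factor `D²`
in the denominator. Since `u = z + ⋯`, a polynomial in `u` of degree less than `N` that vanishes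
modulo `z ^ N` is zero, so that the formula for `M_r(n)` holds for all `n` as soon as it holds for
`n < 6 r + 2` (`motzkinPowerSum_eq_of_forall_lt`).

These finitely many cases are evaluated in the kernel (`checkFrom_eq_true`). Modulo `b ^ 21`, for a
large base `b`, the base `b` digits of `A_n(1 + b)` are the sums of `(area choose j)` over the
paths, `j ≤ 20`, because `(1 + b) ^ a = ∑ (a choose j) b ^ j`; the recurrence thus produces these
sums from several thousand multiplications of integers, and `a (a choose j) =
j (a choose j) + (j + 1) (a choose (j + 1))` turns them into power sums.
-/

/-! ### Area generating functions and the first-return recurrence -/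

/-- The area generating function `A_n(q)` of the Motzkin paths of length `n`, given by the
recurrence that cuts a path at its first return to the axis. -/
def areaGF {R : Type*} [CommSemiring R] (q : R) : ℕ → R
  | 0 => 1
  | n + 1 => areaGF q n + ∑ k : Fin n, q ^ ((k : ℕ) + 1) * areaGF q k * areaGF q (n - 1 - k)

theorem areaGF_zero {R : Type*} [CommSemiring R] (q : R) : areaGF q 0 = 1 := by
  rw [areaGF]

theorem areaGF_succ {R : Type*} [CommSemiring R] (q : R) (n : ℕ) :
    areaGF q (n + 1) = areaGF q n +
      ∑ k ∈ Finset.range n, q ^ (k + 1) * areaGF q k * areaGF q (n - 1 - k) := by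
  rw [areaGF, Finset.sum_range]

theorem pathHeight_zero {n : ℕ} (s : Fin n → SignType) : pathHeight s 0 = 0 := by
  simp [pathHeight]

theorem pathHeight_cons {n : ℕ} (d : SignType) (s : Fin n → SignType) (k : ℕ) :
    pathHeight (Fin.cons d s : Fin (n + 1) → SignType) (k + 1) = d + pathHeight s k := by
  simp only [pathHeight, Finset.sum_filter, Fin.sum_univ_succ]
  simp

/-- The path that starts at height `h` and has step sequence `s` stays non-negative and ends at
height `0`. -/
def IsWalkFrom {n : ℕ} (h : ℤ) (s : Fin n → SignType) : Prop :=
  (∀ k ≤ n, 0 ≤ h + pathHeight s k) ∧ h + pathHeight s n = 0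

theorem isWalkFrom_cons {n : ℕ} (h : ℕ) (d : SignType) (s : Fin n → SignType) :
    IsWalkFrom (h : ℤ) (Fin.cons d s : Fin (n + 1) → SignType) ↔ IsWalkFrom ((h : ℤ) + d) s := by
  unfold IsWalkFrom
  rw [pathHeight_cons, ← add_assoc]
  refine and_congr_left fun _ => ⟨fun H k hk => ?_, fun H k hk => ?_⟩
  · have := H (k + 1) (by omega)
    rwa [pathHeight_cons, ← add_assoc] at this
  · cases k with
    | zero => simp [pathHeight_zero]
    | succ k => rw [pathHeight_cons, ← add_assoc]; exact H k (by omega)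

open Classical in
/-- The sum of `q ^ area` over the non-negative paths of length `n` from height `h` to height `0`.
The area is taken as the sum of the heights before each step; for `h = 0` this is the area under
the path. -/
noncomputable def walkSum {R : Type*} [CommSemiring R] (q : R) (n : ℕ) (h : ℤ) : R :=
  ∑ s : Fin n → SignType,
    if IsWalkFrom h s then q ^ (∑ k ∈ Finset.range n, (h + pathHeight s k).toNat) else 0

section
variable {R : Type*} [CommSemiring R] (q : R)

theorem walkSum_zero (h : ℤ) : walkSum q 0 h = if h = 0 then 1 else 0 := by
  have : ∀ s : Fin 0 → SignType, IsWalkFrom h s ↔ h = 0 := by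
    intro s
    simp only [IsWalkFrom, nonpos_iff_eq_zero, forall_eq, pathHeight_zero, add_zero]
    omega
  simp [walkSum, this]

theorem walkSum_neg_one (n : ℕ) : walkSum q n (-1) = 0 := by
  refine Finset.sum_eq_zero fun s _ => if_neg fun H => ?_
  have := H.1 0 (Nat.zero_le _)
  simp [pathHeight_zero] at this

theorem walkSum_succ (n h : ℕ) :
    walkSum q (n + 1) (h : ℤ) =
      q ^ h * (walkSum q n ((h : ℤ) - 1) + walkSum q n h + walkSum q n ((h : ℤ) + 1)) := by
  classical
  have key : ∀ d : SignType, (∑ s : Fin n → SignType,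
      if IsWalkFrom (h : ℤ) (Fin.cons d s : Fin (n + 1) → SignType) then
        q ^ (∑ k ∈ Finset.range (n + 1),
          ((h : ℤ) + pathHeight (Fin.cons d s : Fin (n + 1) → SignType) k).toNat) else 0) =
      q ^ h * walkSum q n ((h : ℤ) + d) := by
    intro d
    rw [walkSum, Finset.mul_sum]
    refine Finset.sum_congr rfl fun s _ => ?_
    rw [Finset.sum_range_succ', pathHeight_zero]
    simp only [isWalkFrom_cons, pathHeight_cons, ← add_assoc]
    split_ifs
    · rw [pow_add, mul_comm]; simp
    · simp
  have huniv : (Finset.univ : Finset SignType) = {-1, 0, 1} := by decide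
  rw [walkSum, ← (Fin.consEquiv fun _ : Fin (n + 1) => SignType).sum_comp,
    Fintype.sum_prod_type]
  refine (Finset.sum_congr rfl fun d _ => key d).trans ?_
  rw [huniv, Finset.sum_insert (by decide), Finset.sum_insert (by decide), Finset.sum_singleton]
  simp [mul_add, sub_eq_add_neg, add_assoc]

theorem rescale_C_eq (a b : R) :
    PowerSeries.rescale a (PowerSeries.C b) = PowerSeries.C b := by
  ext n
  rw [PowerSeries.coeff_rescale, PowerSeries.coeff_C]
  split_ifs with hn
  · simp [hn]
  · simp

theorem rescale_X_eq (a : R) :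
    PowerSeries.rescale a (PowerSeries.X : PowerSeries R) = PowerSeries.C a * PowerSeries.X := by
  ext n
  rw [PowerSeries.coeff_rescale, PowerSeries.coeff_C_mul, PowerSeries.coeff_X]
  split_ifs with hn
  · simp [hn]
  · simp

open PowerSeries in
/-- The recurrence of `areaGF` as a functional equation: `F(z) = 1 + z F(z) + z² q F(q z) F(z)`. -/
theorem mk_areaGF_eq :
    PowerSeries.mk (areaGF q) = 1 + X * PowerSeries.mk (areaGF q) +
      X ^ 2 * C q * PowerSeries.rescale q (PowerSeries.mk (areaGF q)) *
        PowerSeries.mk (areaGF q) := by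
  rw [show X ^ 2 * C q * PowerSeries.rescale q (PowerSeries.mk (areaGF q)) *
        PowerSeries.mk (areaGF q) = X * (X * (C q * (PowerSeries.rescale q
        (PowerSeries.mk (areaGF q)) * PowerSeries.mk (areaGF q)))) by ring]
  ext n
  rcases n with _ | _ | n
  · simp [areaGF_zero]
  · simp [areaGF_zero, areaGF_succ, coeff_succ_X_mul]
  · simp only [map_add, coeff_succ_X_mul, coeff_one, coeff_mk, coeff_C_mul]
    rw [areaGF_succ, coeff_mul, Finset.Nat.sum_antidiagonal_eq_sum_range_succ_mk, Finset.mul_sum]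
    simp only [coeff_rescale, coeff_mk, Nat.add_sub_cancel, pow_succ]
    rw [if_neg (by omega), zero_add]
    congr 1
    exact Finset.sum_congr rfl fun k _ => by ring

open PowerSeries in
/-- The generating function of the non-negative paths from height `h` to height `0`: such a path
is a Motzkin path raised by `h`, a down step, a Motzkin path raised by `h - 1`, a down step, and
so on; raising a path by `i` replaces `z` by `q ^ i z`. -/
noncomputable def descentSeries : ℕ → R⟦X⟧
  | 0 => PowerSeries.mk (areaGF q)
  | h + 1 => C (q ^ (h + 1)) * X * descentSeries h *
      PowerSeries.rescale (q ^ (h + 1)) (PowerSeries.mk (areaGF q))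

open PowerSeries in
/-- The decomposition by the first step, for paths that start at height `h + 1`. It is the
functional equation of `F(q ^ (h + 1) z)`, multiplied by the remaining factors of
`descentSeries q (h + 1)`. -/
theorem descentSeries_succ_eq (h : ℕ) :
    descentSeries q (h + 1) = X * (C (q ^ (h + 1)) *
      (descentSeries q h + descentSeries q (h + 1) + descentSeries q (h + 2))) := by
  set F := PowerSeries.mk (areaGF q) with hF
  have e : PowerSeries.rescale (q ^ (h + 1)) F = 1 + C (q ^ (h + 1)) * X *
      PowerSeries.rescale (q ^ (h + 1)) F + (C (q ^ (h + 1)) * X) ^ 2 * C q *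
      PowerSeries.rescale (q ^ (h + 2)) F * PowerSeries.rescale (q ^ (h + 1)) F := by
    conv_lhs => rw [hF, mk_areaGF_eq, ← hF]
    rw [show q ^ (h + 2) = q * q ^ (h + 1) by ring, ← rescale_rescale]
    simp only [map_add, map_mul, map_one, map_pow, rescale_C_eq, rescale_X_eq]
  have h2 : descentSeries q (h + 2) = C (q ^ (h + 2)) * X *
    (C (q ^ (h + 1)) * X * descentSeries q h * PowerSeries.rescale (q ^ (h + 1)) F) *
      PowerSeries.rescale (q ^ (h + 2)) F := by rw [descentSeries, descentSeries]
  have h1 : descentSeries q (h + 1) =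
    C (q ^ (h + 1)) * X * descentSeries q h * PowerSeries.rescale (q ^ (h + 1)) F := by
      rw [descentSeries]
  rw [h2, h1]
  conv_lhs => rw [e]
  simp only [map_pow]
  ring

open PowerSeries in
theorem descentSeries_zero_eq :
    descentSeries q 0 = 1 + X * (descentSeries q 0 + descentSeries q 1) := by
  have h1 : descentSeries q 1 =
    C (q ^ 1) * X * descentSeries q 0 *
      PowerSeries.rescale (q ^ 1) (PowerSeries.mk (areaGF q)) := by
      rw [descentSeries]; rfl
  rw [h1]
  simp only [descentSeries, pow_one]
  conv_lhs => rw [mk_areaGF_eq]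
  ring

/-- Both sides satisfy the recurrence given by the first step, which determines them. -/
theorem coeff_descentSeries (n h : ℕ) :
    PowerSeries.coeff n (descentSeries q h) = walkSum q n h := by
  induction n generalizing h with
  | zero =>
    rw [walkSum_zero]
    cases h with
    | zero => simp [descentSeries, areaGF_zero]
    | succ h => rw [descentSeries_succ_eq]; simp; omega
  | succ n ih =>
    rw [walkSum_succ]
    cases h with
    | zero =>
      rw [descentSeries_zero_eq]
      simp [PowerSeries.coeff_succ_X_mul, PowerSeries.coeff_one, ih, walkSum_neg_one]
    | succ h =>
      rw [descentSeries_succ_eq, PowerSeries.coeff_succ_X_mul, PowerSeries.coeff_C_mul]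
      simp only [map_add, ih]
      push_cast
      simp [add_assoc]

/-- The sum of the heights of a path at the abscissae `0, …, n - 1`, which is the area under it if
it is a Motzkin path. -/
def latticeArea {n : ℕ} (s : Fin n → SignType) : ℕ :=
  ∑ k ∈ Finset.range n, (pathHeight s k).toNat

theorem sum_pow_latticeArea (n : ℕ) :
    ∑ s ∈ motzkinPaths n, q ^ latticeArea s = areaGF q n := by
  classical
  have := coeff_descentSeries q n 0
  rw [descentSeries, PowerSeries.coeff_mk] at this
  rw [this, walkSum, motzkinPaths, Finset.sum_filter]
  simp [IsWalkFrom, latticeArea]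

end

theorem pathArea_eq_latticeArea {n : ℕ} {s : Fin n → SignType} (hs : s ∈ motzkinPaths n) :
    pathArea s = latticeArea s := by
  simp only [motzkinPaths, Finset.mem_filter, Finset.mem_univ, true_and] at hs
  have h1 : ∑ k ∈ Finset.range n, (pathHeight s (k + 1) : ℚ) =
      ∑ k ∈ Finset.range n, (pathHeight s k : ℚ) := by
    have := Finset.sum_range_succ (fun k => (pathHeight s k : ℚ)) n
    rw [Finset.sum_range_succ', pathHeight_zero, hs.2] at this
    simpa using this
  rw [pathArea, ← Finset.sum_div, Finset.sum_add_distrib, h1, latticeArea, add_self_div_two]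
  push_cast
  refine Finset.sum_congr rfl fun k hk => ?_
  have := hs.1 k (Finset.mem_range.1 hk).le
  exact_mod_cast (Int.toNat_of_nonneg this).symm

/-! ### Motzkin numbers -/

/-- The number of `(a + b + 1)`-subsets of `n + 1` points, sorted by their `(a + 1)`-st element. -/
theorem sum_choose_mul_choose_sub (n a b : ℕ) :
    ∑ k ∈ Finset.range (n + 1), k.choose a * (n - k).choose b = (n + 1).choose (a + b + 1) := by
  induction n generalizing b with
  | zero =>
    cases a <;> cases b <;> simp <;> exact (Nat.choose_eq_zero_of_lt (by omega)).symm
  | succ n ih =>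
    cases b with
    | zero =>
      have := ih 0
      simp only [Nat.choose_zero_right, mul_one, add_zero] at this ⊢
      rw [Finset.sum_range_succ, this, Nat.choose_succ_succ' (n + 1), add_comm]
    | succ b =>
      rw [Finset.sum_range_succ, Nat.sub_self, Nat.choose_zero_succ, mul_zero, add_zero,
        Nat.choose_succ_succ' (n + 1), ← ih (b + 1), ← add_assoc a b 1, ← ih b,
        ← Finset.sum_add_distrib]
      refine Finset.sum_congr rfl fun k hk => ?_
      have := Finset.mem_range.1 hk
      rw [show n + 1 - k = n - k + 1 by omega, Nat.choose_succ_succ, mul_add]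

theorem motzkinNumber_eq_sum_range {n N : ℕ} (h : n / 2 < N) :
    motzkinNumber n = ∑ k ∈ Finset.range N, n.choose (2 * k) * catalan k := by
  refine Finset.sum_subset (Finset.range_mono h) fun k _ hk => ?_
  rw [Nat.choose_eq_zero_of_lt (by rw [Finset.mem_range] at hk; omega), zero_mul]

theorem motzkinNumber_eq_one_add {n N : ℕ} (h : n / 2 ≤ N) :
    motzkinNumber n =
      ∑ m ∈ Finset.range N, n.choose (2 * m + 2) * catalan (m + 1) + 1 := by
  rw [motzkinNumber_eq_sum_range (Nat.lt_succ_of_le h), Finset.sum_range_succ']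
  simp [mul_add]

theorem sum_motzkinNumber_mul (n : ℕ) :
    ∑ k ∈ Finset.range (n + 1), motzkinNumber k * motzkinNumber (n - k) =
      ∑ m ∈ Finset.range (n + 1), (n + 1).choose (2 * m + 1) * catalan (m + 1) := by
  have h1 : ∀ k ∈ Finset.range (n + 1), motzkinNumber k * motzkinNumber (n - k) =
      ∑ i ∈ Finset.range (n + 1), ∑ j ∈ Finset.range (n + 1),
        k.choose (2 * i) * (n - k).choose (2 * j) * (catalan i * catalan j) := by
    intro k hk
    have := Finset.mem_range.1 hk
    rw [motzkinNumber_eq_sum_range (N := n + 1) (by omega),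
      motzkinNumber_eq_sum_range (n := n - k) (N := n + 1) (by omega), Finset.sum_mul_sum]
    exact Finset.sum_congr rfl fun i _ => Finset.sum_congr rfl fun j _ => by ring
  have h2 : ∀ m ∈ Finset.range (n + 1), (n + 1).choose (2 * m + 1) * catalan (m + 1) =
      ∑ i ∈ Finset.range (m + 1), (n + 1).choose (2 * (i + (m - i)) + 1) *
        (catalan i * catalan (m - i)) := by
    intro m _
    rw [catalan_succ', Finset.Nat.sum_antidiagonal_eq_sum_range_succ_mk, Finset.mul_sum]
    refine Finset.sum_congr rfl fun i hi => ?_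
    have := Finset.mem_range.1 hi
    rw [show i + (m - i) = m by omega]
  rw [Finset.sum_congr rfl h1, Finset.sum_comm, Finset.sum_congr rfl h2,
    Finset.sum_range_diag_flip (n + 1)
      fun i j => (n + 1).choose (2 * (i + j) + 1) * (catalan i * catalan j)]
  refine Finset.sum_congr rfl fun i _ => ?_
  rw [Finset.sum_comm]
  simp_rw [← Finset.sum_mul, sum_choose_mul_choose_sub, ← mul_add]
  refine (Finset.sum_subset (Finset.range_mono (Nat.sub_le _ _)) fun j _ hj => ?_).symm
  rw [Nat.choose_eq_zero_of_lt (by rw [Finset.mem_range] at hj; omega), zero_mul]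

theorem motzkinNumber_add_two (n : ℕ) :
    motzkinNumber (n + 2) = motzkinNumber (n + 1) +
      ∑ k ∈ Finset.range (n + 1), motzkinNumber k * motzkinNumber (n - k) := by
  rw [sum_motzkinNumber_mul, motzkinNumber_eq_one_add (N := n + 1) (by omega),
    motzkinNumber_eq_one_add (n := n + 1) (N := n + 1) (by omega), add_right_comm,
    ← Finset.sum_add_distrib]
  congr 1
  refine Finset.sum_congr rfl fun m _ => ?_
  rw [Nat.choose_succ_succ' (n + 1) (2 * m + 1)]
  ring

theorem areaGF_one_eq_motzkinNumber (n : ℕ) : areaGF 1 n = motzkinNumber n := by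
  induction n using Nat.strong_induction_on with
  | _ n ih =>
    rcases n with _ | _ | n
    · simp [areaGF_zero, motzkinNumber]
    · simp [areaGF_zero, areaGF_succ, motzkinNumber]
    · rw [areaGF_succ, motzkinNumber_add_two, ih _ (by omega)]
      congr 1
      refine Finset.sum_congr rfl fun k hk => ?_
      have := Finset.mem_range.1 hk
      rw [ih _ (by omega), ih _ (by omega), one_pow, one_mul]
      rfl

/-! ### Power series of the moments -/

open PowerSeries in
theorem coeff_exp_pow (r a : ℕ) :
    coeff r ((exp ℚ) ^ a) = (a : ℚ) ^ r / r.factorial := by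
  rw [exp_pow_eq_rescale_exp, coeff_rescale, coeff_exp]
  simp [div_eq_mul_inv]

/-- The series `F_r = ∑ M_r(n) / r! z ^ n`, whose `n`-th coefficient is read off from
`A_n(exp t)`. -/
noncomputable def momentSeries (r : ℕ) : PowerSeries ℚ :=
  PowerSeries.mk fun n => PowerSeries.coeff r (areaGF (PowerSeries.exp ℚ) n)

theorem coeff_momentSeries (r n : ℕ) :
    PowerSeries.coeff n (momentSeries r) = motzkinPowerSum r n / r.factorial := by
  rw [momentSeries, PowerSeries.coeff_mk, ← sum_pow_latticeArea, map_sum, motzkinPowerSum,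
    Finset.sum_div]
  refine Finset.sum_congr rfl fun s hs => ?_
  rw [coeff_exp_pow, pathArea_eq_latticeArea hs]

/-- The operator `f ↦ d/dz (z f)`, which multiplies the `n`-th coefficient by `n + 1`. -/
noncomputable def eulerShift (f : PowerSeries ℚ) : PowerSeries ℚ :=
  f + PowerSeries.X * PowerSeries.derivative ℚ f

theorem coeff_eulerShift (f : PowerSeries ℚ) (n : ℕ) :
    PowerSeries.coeff n (eulerShift f) = (n + 1) * PowerSeries.coeff n f := by
  cases n with
  | zero => simp [eulerShift]
  | succ n =>
    rw [eulerShift, map_add, PowerSeries.coeff_succ_X_mul, PowerSeries.coeff_derivative]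
    push_cast; ring

theorem coeff_eulerShift_iterate (f : PowerSeries ℚ) (k n : ℕ) :
    PowerSeries.coeff n (eulerShift^[k] f) = (n + 1) ^ k * PowerSeries.coeff n f := by
  induction k with
  | zero => simp
  | succ k ih => rw [Function.iterate_succ_apply', coeff_eulerShift, ih]; ring

/-- The series `H_r = ∑_{k+j=r} E ^ k F_j / k!` with `E` the operator `eulerShift`. Its `n`-th
coefficient is that of `t ^ r` in `q ^ (n + 1) A_n(q)` with `q = exp t`: a Motzkin path preceded by
an up step and followed by a down step gains the area `n + 1`. -/
noncomputable def raisedSeries (r : ℕ) : PowerSeries ℚ :=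
  ∑ p ∈ Finset.HasAntidiagonal.antidiagonal r,
    (p.1.factorial : ℚ)⁻¹ • eulerShift^[p.1] (momentSeries p.2)

open PowerSeries in
theorem coeff_raisedSeries (r n : ℕ) :
    coeff n (raisedSeries r) = coeff r (exp ℚ ^ (n + 1) * areaGF (exp ℚ) n) := by
  rw [raisedSeries, map_sum, coeff_mul]
  refine Finset.sum_congr rfl fun p _ => ?_
  rw [coeff_smul, coeff_eulerShift_iterate, coeff_exp_pow, momentSeries, coeff_mk]
  push_cast
  rw [smul_eq_mul]; ring

open PowerSeries in
/-- The recurrence of the moments: the coefficient of `t ^ r` in the first-return recurrence at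
`q = exp t`. -/
theorem momentSeries_eq (r : ℕ) :
    momentSeries r = (if r = 0 then 1 else 0) + X * momentSeries r +
      X ^ 2 * ∑ p ∈ Finset.HasAntidiagonal.antidiagonal r, raisedSeries p.1 * momentSeries p.2 := by
  rw [pow_two, mul_assoc]
  ext n
  rcases n with _ | _ | n
  · rw [momentSeries, coeff_mk, areaGF_zero, coeff_one]
    split_ifs <;> simp
  · simp only [map_add, coeff_succ_X_mul, momentSeries, coeff_mk, areaGF_succ]
    split_ifs <;> simp
  · simp only [map_add, coeff_succ_X_mul]
    have h0 : coeff (n + 2) (if r = 0 then 1 else 0 : PowerSeries ℚ) = 0 := by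
      split_ifs <;> simp [coeff_one]
    rw [h0, zero_add, momentSeries, coeff_mk, coeff_mk, areaGF_succ, map_add, map_sum, map_sum]
    congr 1
    have h1 : ∀ i j, coeff n (raisedSeries i * momentSeries j) =
        ∑ k ∈ Finset.range (n + 1), coeff i (exp ℚ ^ (k + 1) * areaGF (exp ℚ) k) *
          coeff j (areaGF (exp ℚ) (n - k)) := by
      intro i j
      rw [coeff_mul, Finset.Nat.sum_antidiagonal_eq_sum_range_succ_mk]
      simp only [coeff_raisedSeries, momentSeries, coeff_mk, Nat.succ_eq_add_one]
    simp only [h1]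
    rw [Finset.sum_comm]
    exact Finset.sum_congr rfl fun k _ => coeff_mul r _ _

/-! ### Rational functions of the uniformising series -/

section
variable (w : PowerSeries ℚ)

/-- `F = w p(u) / (1 - u²) ^ e` with `u = z w` and a polynomial `p` of degree at most `2 e + δ`. The
degree is measured against that of `(1 - u²) ^ e`, so that `δ` adds up in products. -/
def HasRationalForm (e δ : ℕ) (F : PowerSeries ℚ) : Prop :=
  ∃ p : Polynomial ℚ, p.natDegree ≤ 2 * e + δ ∧
    (1 - (PowerSeries.X * w) ^ 2) ^ e * F = w * Polynomial.aeval (PowerSeries.X * w) p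

variable {w}

namespace HasRationalForm

theorem zero (e δ : ℕ) : HasRationalForm w e δ 0 := ⟨0, by simp, by simp⟩

theorem add {e δ : ℕ} {F G : PowerSeries ℚ} (hF : HasRationalForm w e δ F)
    (hG : HasRationalForm w e δ G) : HasRationalForm w e δ (F + G) := by
  obtain ⟨p, hp, hF⟩ := hF
  obtain ⟨q, hq, hG⟩ := hG
  exact ⟨p + q, (Polynomial.natDegree_add_le p q).trans (max_le hp hq), by
    rw [mul_add, hF, hG, map_add, mul_add]⟩

theorem smul {e δ : ℕ} {F : PowerSeries ℚ} (hF : HasRationalForm w e δ F) (c : ℚ) :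
    HasRationalForm w e δ (c • F) := by
  obtain ⟨p, hp, hF⟩ := hF
  exact ⟨c • p, (Polynomial.natDegree_smul_le c p).trans hp, by
    rw [mul_smul_comm, hF, map_smul, mul_smul_comm]⟩

theorem sum {ι : Type*} {e δ : ℕ} {s : Finset ι} {F : ι → PowerSeries ℚ}
    (h : ∀ i ∈ s, HasRationalForm w e δ (F i)) : HasRationalForm w e δ (∑ i ∈ s, F i) :=
  Finset.sum_induction _ _ (fun _ _ => add) (zero e δ) h

theorem mono {e e' δ δ' : ℕ} {F : PowerSeries ℚ} (hF : HasRationalForm w e δ F)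
    (he : e ≤ e') (hδ : δ ≤ δ') : HasRationalForm w e' δ' F := by
  obtain ⟨p, hp, hF⟩ := hF
  obtain ⟨k, rfl⟩ := Nat.exists_eq_add_of_le he
  refine ⟨(1 - Polynomial.X ^ 2) ^ k * p, ?_, ?_⟩
  · have : ((1 - Polynomial.X ^ 2 : Polynomial ℚ) ^ k * p).natDegree ≤ k * 2 + p.natDegree := by
      compute_degree
    omega
  · simp only [map_mul, map_pow, map_sub, map_one, Polynomial.aeval_X]
    rw [pow_add]
    linear_combination (1 - (PowerSeries.X * w) ^ 2) ^ k * hF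

theorem self : HasRationalForm w 0 0 w := ⟨1, by simp, by simp⟩

theorem tail : HasRationalForm w 0 1 (w * (1 + PowerSeries.X * w)) :=
  ⟨1 + Polynomial.X, by compute_degree, by simp⟩

end HasRationalForm

theorem mk_pow_mul_one_sub (c : ℚ) :
    (PowerSeries.mk fun n => c ^ n) * (1 - PowerSeries.C c * PowerSeries.X) = 1 := by
  have h : (PowerSeries.mk fun n => c ^ n) =
      1 + PowerSeries.X * (PowerSeries.C c * PowerSeries.mk fun n => c ^ n) := by
    ext n
    cases n with
    | zero => simp
    | succ n =>
      rw [map_add, PowerSeries.coeff_succ_X_mul]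
      simp [PowerSeries.coeff_one, pow_succ']
  linear_combination h

theorem constantCoeff_aeval_X_mul (w : PowerSeries ℚ) (q : Polynomial ℚ) :
    PowerSeries.constantCoeff (Polynomial.aeval (PowerSeries.X * w) q) = q.coeff 0 := by
  rw [Polynomial.aeval_def, Polynomial.hom_eval₂]
  simp [Polynomial.eval₂_at_zero]

theorem natDegree_X_mul_derivative_le (p : Polynomial ℚ) :
    (Polynomial.X * Polynomial.derivative p).natDegree ≤ p.natDegree := by
  rcases Nat.eq_zero_or_pos p.natDegree with h | h
  · rw [Polynomial.derivative_of_natDegree_zero h, mul_zero, Polynomial.natDegree_zero]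
    exact Nat.zero_le _
  · refine Polynomial.natDegree_mul_le.trans ?_
    have := Polynomial.natDegree_derivative_le p
    rw [Polynomial.natDegree_X]
    omega

section
variable (hw : w = 1 + PowerSeries.X * w + PowerSeries.X ^ 2 * (w * w))
include hw

/-- For `u = z w`, `z du/dz = u w / (1 - u²)`. -/
theorem X_mul_derivative_mul :
    PowerSeries.X * PowerSeries.derivative ℚ (PowerSeries.X * w) *
      (1 - (PowerSeries.X * w) ^ 2) = PowerSeries.X * w * w := by
  have h1 := congrArg (PowerSeries.derivative ℚ) hw
  have h2 : PowerSeries.derivative ℚ (PowerSeries.X * w) =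
      w + PowerSeries.X * PowerSeries.derivative ℚ w := by
    simp [Derivation.leibniz]; ring
  simp only [map_add, Derivation.leibniz, Derivation.leibniz_pow, PowerSeries.derivative_X,
    Derivation.map_one_eq_zero, smul_eq_mul, nsmul_eq_mul] at h1
  rw [h2]
  generalize PowerSeries.derivative ℚ w = v at *
  push_cast at h1
  linear_combination PowerSeries.X ^ 2 * w * h1 - PowerSeries.X * (w + PowerSeries.X * v) * hw

/-- The image of `w p(u) / D ^ e`, where `D = 1 - u²`, under `z d/dz` is
`w (D (1 + 2 u) u p + D (1 + u + u²) u p' + 2 e u² (1 + u + u²) p) / D ^ (e + 2)`. -/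
theorem HasRationalForm.eulerShift_add_two {e δ : ℕ} {F : PowerSeries ℚ}
    (hF : HasRationalForm w e δ F) :
    HasRationalForm w (e + 2) δ (eulerShift F) := by
  obtain ⟨p, hp, hF⟩ := hF
  have hu := X_mul_derivative_mul hw
  set u := PowerSeries.X * w with hu'
  have hw' : w = 1 + u + u ^ 2 := by rw [hu']; linear_combination hw
  have h1 := congrArg (PowerSeries.derivative ℚ) hF
  have h2 := congrArg (PowerSeries.derivative ℚ) hw'
  rw [HasRationalForm, ← hu']
  clear_value u
  refine ⟨(1 - Polynomial.X ^ 2) ^ 2 * p +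
    (1 - Polynomial.X ^ 2) * (1 + 2 * Polynomial.X) * Polynomial.X * p +
    (1 - Polynomial.X ^ 2) * (1 + Polynomial.X + Polynomial.X ^ 2) *
      (Polynomial.X * Polynomial.derivative p) +
    2 * (e : Polynomial ℚ) * Polynomial.X ^ 2 * (1 + Polynomial.X + Polynomial.X ^ 2) * p, ?_, ?_⟩
  · have h4 := natDegree_X_mul_derivative_le p
    generalize Polynomial.X * Polynomial.derivative p = q at *
    have h5 : ∀ a b : Polynomial ℚ, a.natDegree ≤ 4 → b.natDegree ≤ p.natDegree →
        (a * b).natDegree ≤ 2 * (e + 2) + δ := fun a b ha hb =>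
      Polynomial.natDegree_mul_le.trans (by omega)
    refine Polynomial.natDegree_add_le_of_degree_le (Polynomial.natDegree_add_le_of_degree_le
      (Polynomial.natDegree_add_le_of_degree_le (h5 _ _ ?_ le_rfl) (h5 _ _ ?_ le_rfl))
      (h5 _ _ ?_ h4)) (h5 _ _ ?_ le_rfl)
    all_goals compute_degree
  · have h3 : (1 - u ^ 2) * PowerSeries.derivative ℚ ((1 - u ^ 2) ^ e) =
        - (2 * e * u * (1 - u ^ 2) ^ e * PowerSeries.derivative ℚ u) := by
      cases e with
      | zero => simp
      | succ e =>
        simp only [Derivation.leibniz_pow, map_sub, Derivation.map_one_eq_zero, smul_eq_mul,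
          nsmul_eq_mul]
        push_cast
        ring
    simp only [Derivation.leibniz, smul_eq_mul, Derivation.map_aeval] at h1
    simp only [map_add, Derivation.map_one_eq_zero, Derivation.leibniz_pow, smul_eq_mul,
      nsmul_eq_mul] at h2
    simp only [map_mul, map_pow, map_sub, map_one, map_add, Polynomial.aeval_X, map_natCast,
      map_ofNat, _root_.eulerShift]
    generalize PowerSeries.derivative ℚ F = dF at *
    generalize PowerSeries.derivative ℚ w = dw at *
    generalize PowerSeries.derivative ℚ u = du at *
    generalize PowerSeries.derivative ℚ ((1 - u ^ 2) ^ e) = dD at *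
    generalize Polynomial.aeval u p = P at *
    generalize Polynomial.aeval u (Polynomial.derivative p) = P' at *
    rw [pow_add]
    generalize (1 - u ^ 2) ^ e = E at *
    linear_combination (1 - u ^ 2) ^ 2 * hF + PowerSeries.X * (1 - u ^ 2) ^ 2 * h1 +
      (1 - u ^ 2) * w * P' * hu + (1 - u ^ 2) * w * P' * u * hw' +
      PowerSeries.X * (1 - u ^ 2) ^ 2 * P * h2 + (1 - u ^ 2) * P * (1 + 2 * u) * hu -
      PowerSeries.X * (1 - u ^ 2) * F * h3 + 2 * e * u * F * E * hu + 2 * e * u ^ 2 * w * hF +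
      2 * e * u ^ 2 * w * P * hw'

/-- Without a denominator, `z d/dz` introduces only one factor `1 - u²`. -/
theorem HasRationalForm.eulerShift_add_one {δ : ℕ} {F : PowerSeries ℚ}
    (hF : HasRationalForm w 0 δ F) : HasRationalForm w 1 δ (eulerShift F) := by
  obtain ⟨p, hp, hF⟩ := hF
  have hu := X_mul_derivative_mul hw
  set u := PowerSeries.X * w with hu'
  have hw' : w = 1 + u + u ^ 2 := by rw [hu']; linear_combination hw
  have h1 := congrArg (PowerSeries.derivative ℚ) hF
  have h2 := congrArg (PowerSeries.derivative ℚ) hw'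
  rw [HasRationalForm, ← hu']
  clear_value u
  refine ⟨(1 - Polynomial.X ^ 2) * p + (1 + 2 * Polynomial.X) * Polynomial.X * p +
    (1 + Polynomial.X + Polynomial.X ^ 2) * (Polynomial.X * Polynomial.derivative p), ?_, ?_⟩
  · have h4 := natDegree_X_mul_derivative_le p
    generalize Polynomial.X * Polynomial.derivative p = q at *
    have h5 : ∀ a b : Polynomial ℚ, a.natDegree ≤ 2 → b.natDegree ≤ p.natDegree →
        (a * b).natDegree ≤ 2 * 1 + δ := fun a b ha hb =>
      Polynomial.natDegree_mul_le.trans (by omega)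
    refine Polynomial.natDegree_add_le_of_degree_le
      (Polynomial.natDegree_add_le_of_degree_le (h5 _ _ ?_ le_rfl) (h5 _ _ ?_ le_rfl))
      (h5 _ _ ?_ h4)
    all_goals compute_degree
  · simp only [pow_zero, one_mul, Derivation.leibniz, smul_eq_mul, Derivation.map_aeval] at hF h1
    simp only [map_add, Derivation.map_one_eq_zero, Derivation.leibniz_pow, smul_eq_mul,
      nsmul_eq_mul] at h2
    simp only [map_mul, map_pow, map_sub, map_one, map_add, Polynomial.aeval_X, map_ofNat,
      _root_.eulerShift]
    generalize PowerSeries.derivative ℚ F = dF at *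
    generalize PowerSeries.derivative ℚ w = dw at *
    generalize PowerSeries.derivative ℚ u = du at *
    generalize Polynomial.aeval u p = P at *
    generalize Polynomial.aeval u (Polynomial.derivative p) = P' at *
    linear_combination (1 - u ^ 2) * hF + PowerSeries.X * (1 - u ^ 2) * h1 +
      w * P' * hu + w * P' * u * hw' + PowerSeries.X * (1 - u ^ 2) * P * h2 +
      P * (1 + 2 * u) * hu

theorem HasRationalForm.eulerShift_iterate {e δ : ℕ} {F : PowerSeries ℚ}
    (hF : HasRationalForm w e δ F) (k : ℕ) :
    HasRationalForm w (e + 2 * k) δ (eulerShift^[k] F) := by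
  induction k with
  | zero => exact hF
  | succ k ih =>
    rw [Function.iterate_succ_apply']
    exact HasRationalForm.eulerShift_add_two hw ih

theorem HasRationalForm.natCast_pow_mul {e δ : ℕ} {a : ℕ → ℚ}
    (ha : HasRationalForm w e δ (PowerSeries.mk a)) (k : ℕ) :
    HasRationalForm w (e + 2 * k) δ (PowerSeries.mk fun n => (n : ℚ) ^ k * a n) := by
  induction k with
  | zero => simpa using ha
  | succ k ih =>
    -- `z d/dz` is `eulerShift` minus the identity.
    have := (ih.eulerShift_add_two hw).add ((ih.mono (Nat.le_add_right _ 2) le_rfl).smul (-1))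
    have h : (PowerSeries.mk fun n => (n : ℚ) ^ (k + 1) * a n) =
        _root_.eulerShift (PowerSeries.mk fun n => (n : ℚ) ^ k * a n) +
          (-1 : ℚ) • PowerSeries.mk fun n => (n : ℚ) ^ k * a n := by
      ext n
      rw [map_add, coeff_eulerShift, PowerSeries.coeff_smul, PowerSeries.coeff_mk,
        PowerSeries.coeff_mk, smul_eq_mul]
      ring
    rw [h]
    exact this

theorem HasRationalForm.eval_mul {e δ d : ℕ} {a : ℕ → ℚ}
    (ha : HasRationalForm w e δ (PowerSeries.mk a)) {Q : Polynomial ℚ} (hQ : Q.natDegree ≤ d) :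
    HasRationalForm w (e + 2 * d) δ (PowerSeries.mk fun n => Q.eval (n : ℚ) * a n) := by
  have : (PowerSeries.mk fun n => Q.eval (n : ℚ) * a n) =
      ∑ k ∈ Finset.range (d + 1),
        Q.coeff k • PowerSeries.mk fun n => (n : ℚ) ^ k * a n := by
    ext n
    simp only [map_sum, PowerSeries.coeff_smul, PowerSeries.coeff_mk, smul_eq_mul, ← mul_assoc]
    rw [← Finset.sum_mul, ← Polynomial.eval_eq_sum_range' (Nat.lt_succ_of_le hQ)]
  rw [this]
  refine HasRationalForm.sum fun k hk => ((ha.natCast_pow_mul hw k).mono ?_ le_rfl).smul _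
  have := Finset.mem_range.1 hk
  omega

/-- Solving the moment recurrence for its leading term costs one factor of the denominator, because
`1 - z - 2 z² w = (1 - u²) / w`. -/
theorem HasRationalForm.of_kernel_mul {e e' δ δ' : ℕ} {F G H : PowerSeries ℚ}
    (hF : HasRationalForm w e δ F) (hG : HasRationalForm w e' δ' G)
    (hH : H * (1 - PowerSeries.X - 2 * PowerSeries.X ^ 2 * w) =
      PowerSeries.X ^ 2 * (F * G)) :
    HasRationalForm w (e + e' + 1) (δ + δ') H := by
  obtain ⟨p, hp, hF⟩ := hF
  obtain ⟨q, hq, hG⟩ := hG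
  refine ⟨Polynomial.X ^ 2 * p * q, ?_, ?_⟩
  · have : (Polynomial.X ^ 2 * p * q).natDegree ≤ 2 + p.natDegree + q.natDegree := by
      compute_degree
    omega
  · simp only [map_mul, map_pow, Polynomial.aeval_X]
    have h1 : 1 - (PowerSeries.X * w) ^ 2 =
        (1 - PowerSeries.X - 2 * PowerSeries.X ^ 2 * w) * w := by linear_combination -hw
    rw [pow_add, pow_add, pow_one]
    generalize Polynomial.aeval (PowerSeries.X * w) p = P at *
    generalize Polynomial.aeval (PowerSeries.X * w) q = Q at *
    generalize h2 : 1 - (PowerSeries.X * w) ^ 2 = D at *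
    linear_combination D ^ e * D ^ e' * H * h1 + D ^ e * D ^ e' * w * hH +
      PowerSeries.X ^ 2 * w * G * D ^ e' * hF + PowerSeries.X ^ 2 * w ^ 2 * P * hG

theorem constantCoeff_eq_one : PowerSeries.constantCoeff w = 1 := by
  rw [hw]; simp

theorem hasRationalForm_three_pow :
    HasRationalForm w 2 0 (PowerSeries.mk fun n => (3 : ℚ) ^ n) := by
  have h : (PowerSeries.mk fun n => (3 : ℚ) ^ n) * (1 - 3 * PowerSeries.X) = 1 := by
    rw [show (3 : PowerSeries ℚ) = PowerSeries.C 3 from (map_ofNat _ 3).symm]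
    exact mk_pow_mul_one_sub 3
  refine ⟨(1 + Polynomial.X) ^ 2,
    (by compute_degree : Polynomial.natDegree _ ≤ 2).trans (by norm_num), ?_⟩
  simp only [map_add, map_pow, map_one, Polynomial.aeval_X]
  generalize (PowerSeries.mk fun n => (3 : ℚ) ^ n) = T at *
  linear_combination w * (1 + PowerSeries.X * w) ^ 2 * h - T * (1 + PowerSeries.X * w) ^ 2 * hw

theorem hasRationalForm_neg_one_pow :
    HasRationalForm w 2 0 (PowerSeries.mk fun n => (-1 : ℚ) ^ n) := by
  have h : (PowerSeries.mk fun n => (-1 : ℚ) ^ n) * (1 + PowerSeries.X) = 1 := by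
    simpa using mk_pow_mul_one_sub (-1)
  refine ⟨(1 - Polynomial.X) ^ 2,
    (by compute_degree : Polynomial.natDegree _ ≤ 2).trans (by norm_num), ?_⟩
  simp only [map_sub, map_pow, map_one, Polynomial.aeval_X]
  generalize (PowerSeries.mk fun n => (-1 : ℚ) ^ n) = T at *
  linear_combination w * (1 - PowerSeries.X * w) ^ 2 * h - T * (1 - PowerSeries.X * w) ^ 2 * hw

/-- A polynomial in `u` of degree less than `N` that is divisible by `z ^ N` vanishes, since `u` has
order one. -/
theorem HasRationalForm.eq_zero {e δ : ℕ} {F : PowerSeries ℚ} (hF : HasRationalForm w e δ F)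
    (h : ∀ n < 2 * e + δ + 1, PowerSeries.coeff n F = 0) : F = 0 := by
  obtain ⟨p, hp, hF⟩ := hF
  have hw1 := constantCoeff_eq_one hw
  have hw0 : w ≠ 0 := by rintro rfl; simp at hw1
  have hD : (1 - (PowerSeries.X * w) ^ 2) ^ e ≠ 0 := by
    intro h0
    have := congrArg PowerSeries.constantCoeff h0
    simp at this
  have hdvd : PowerSeries.X ^ (2 * e + δ + 1) ∣ w * Polynomial.aeval (PowerSeries.X * w) p := by
    rw [← hF]
    exact Dvd.dvd.mul_left (PowerSeries.X_pow_dvd_iff.2 h) _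
  suffices p = 0 by
    rw [this, map_zero, mul_zero] at hF
    exact (mul_eq_zero.1 hF).resolve_left hD
  by_contra hp0
  -- Write `p = X ^ k q` with `q(0) ≠ 0`; then `q(0)` is the `k`-th coefficient of `w p(z w)`.
  obtain ⟨q, hq, hq0⟩ := Polynomial.exists_eq_pow_rootMultiplicity_mul_and_not_dvd p hp0 0
  set k := p.rootMultiplicity 0
  rw [Polynomial.C_0, sub_zero] at hq hq0
  have hk : k ≤ p.natDegree := by
    have hq1 : q ≠ 0 := by rintro rfl; exact hq0 (dvd_zero _)
    have := congrArg Polynomial.natDegree hq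
    rw [Polynomial.natDegree_mul (pow_ne_zero _ Polynomial.X_ne_zero) hq1,
      Polynomial.natDegree_X_pow] at this
    omega
  rw [Polynomial.X_dvd_iff] at hq0
  have h1 : w * Polynomial.aeval (PowerSeries.X * w) p = PowerSeries.X ^ k *
      (w ^ (k + 1) * Polynomial.aeval (PowerSeries.X * w) q) := by
    rw [hq]; simp only [map_mul, map_pow, Polynomial.aeval_X]; ring
  have h2 := PowerSeries.X_pow_dvd_iff.1 hdvd k (by omega)
  rw [h1, PowerSeries.coeff_X_pow_mul', if_pos le_rfl, Nat.sub_self,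
    PowerSeries.coeff_zero_eq_constantCoeff_apply, map_mul, map_pow, hw1, one_pow, one_mul] at h2
  apply hq0
  rw [← h2, constantCoeff_aeval_X_mul]

end
end

/-! ### The moment series are rational in the uniformising series -/

open PowerSeries in
theorem momentSeries_zero_eq : momentSeries 0 =
    1 + X * momentSeries 0 + X ^ 2 * (momentSeries 0 * momentSeries 0) := by
  have := momentSeries_eq 0
  simpa [raisedSeries] using this

/-- The bound on the denominator improves by one as soon as at least one operator is applied. For
`j = 0` this uses that `w` has no denominator. -/
theorem hasRationalForm_momentSeries_eulerShift {i j k : ℕ}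
    (h : HasRationalForm (momentSeries 0) (3 * j - 1) 0 (momentSeries j)) (hk : k + j = i)
    (hk0 : k ≠ 0) :
    HasRationalForm (momentSeries 0) (3 * i - 2) 0 (eulerShift^[k] (momentSeries j)) := by
  obtain ⟨k, rfl⟩ := Nat.exists_eq_succ_of_ne_zero hk0
  rcases Nat.eq_zero_or_pos j with rfl | hj
  · rw [Function.iterate_succ_apply]
    exact ((HasRationalForm.self.eulerShift_add_one momentSeries_zero_eq).eulerShift_iterate
      momentSeries_zero_eq k).mono (by omega) le_rfl
  · exact (h.eulerShift_iterate momentSeries_zero_eq (k + 1)).mono (by omega) le_rfl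

open PowerSeries Finset.HasAntidiagonal in
theorem hasRationalForm_momentSeries (r : ℕ) :
    HasRationalForm (momentSeries 0) (3 * r - 1) 0 (momentSeries r) := by
  induction r using Nat.strong_induction_on with
  | _ r ih =>
    rcases Nat.eq_zero_or_pos r with rfl | hr
    · exact HasRationalForm.self
    have hw := momentSeries_zero_eq
    set w := momentSeries 0 with hw0
    set S : PowerSeries ℚ := 1 - X - 2 * X ^ 2 * w with hS
    have hS1 : constantCoeff S ≠ 0 := by simp [hS]
    have hinv : ∀ F : PowerSeries ℚ, X ^ 2 * F * S⁻¹ * S = X ^ 2 * F := fun F => by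
      rw [mul_assoc, PowerSeries.inv_mul_cancel _ hS1, mul_one]
    -- `H` collects the terms of `raisedSeries r` other than `momentSeries r` itself, which moves to
    -- the left-hand side of the recurrence.
    set H : PowerSeries ℚ := ∑ p ∈ (antidiagonal r).erase (0, r),
      (p.1.factorial : ℚ)⁻¹ • eulerShift^[p.1] (momentSeries p.2) with hH
    have hraised : raisedSeries r = momentSeries r + H := by
      rw [raisedSeries, ← Finset.add_sum_erase _ _ (a := (0, r)) (by simp)]
      simp [hH]
    have hHform : HasRationalForm w (3 * r - 2) 0 H := by
      refine HasRationalForm.sum fun p hp => HasRationalForm.smul ?_ _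
      simp only [Finset.mem_erase, mem_antidiagonal, ne_eq, Prod.ext_iff] at hp
      exact hasRationalForm_momentSeries_eulerShift (ih _ (by omega)) hp.2 (by omega)
    -- The terms of index `(0, r)` and `(r, 0)` are the only ones that contain `momentSeries r`.
    have hsum : ∑ p ∈ antidiagonal r, raisedSeries p.1 * momentSeries p.2 =
        2 * (w * momentSeries r) + H * w +
        ∑ p ∈ ((antidiagonal r).erase (0, r)).erase (r, 0),
          raisedSeries p.1 * momentSeries p.2 := by
      rw [← Finset.add_sum_erase _ _ (a := (0, r)) (by simp),
        ← Finset.add_sum_erase _ _ (a := (r, 0)) (by simp; omega), hraised]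
      have : raisedSeries 0 = w := by simp [raisedSeries, hw0]
      rw [this]
      ring
    have hrec : momentSeries r = X ^ 2 * (H * w) * S⁻¹ +
        ∑ p ∈ ((antidiagonal r).erase (0, r)).erase (r, 0),
          X ^ 2 * (raisedSeries p.1 * momentSeries p.2) * S⁻¹ := by
      have h1 := momentSeries_eq r
      rw [if_neg hr.ne', hsum] at h1
      rw [← Finset.sum_mul, ← Finset.mul_sum, ← add_mul, ← mul_add,
        PowerSeries.eq_mul_inv_iff_mul_eq hS1, hS]
      linear_combination h1
    rw [hrec]
    refine HasRationalForm.add ?_ (HasRationalForm.sum fun p hp => ?_)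
    · exact (hHform.of_kernel_mul hw HasRationalForm.self (hinv _)).mono (by omega) le_rfl
    · simp only [Finset.mem_erase, mem_antidiagonal, ne_eq, Prod.ext_iff] at hp
      have h2 : HasRationalForm w (3 * p.1 - 1) 0 (raisedSeries p.1) := by
        refine HasRationalForm.sum fun p' hp' => HasRationalForm.smul ?_ _
        rw [mem_antidiagonal] at hp'
        rcases eq_or_ne p'.1 0 with h0 | h0
        · rw [h0, Function.iterate_zero_apply]
          exact (ih _ (by omega)).mono (by omega) le_rfl
        · exact (hasRationalForm_momentSeries_eulerShift (ih _ (by omega)) hp' h0).mono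
            (by omega) le_rfl
      exact (h2.of_kernel_mul hw (ih p.2 (by omega)) (hinv _)).mono (by omega) le_rfl

theorem motzkinPowerSum_zero (n : ℕ) : motzkinPowerSum 0 n = motzkinNumber n := by
  have := sum_pow_latticeArea 1 n
  rw [areaGF_one_eq_motzkinNumber] at this
  simpa [motzkinPowerSum] using congrArg (Nat.cast : ℕ → ℚ) this

theorem momentSeries_zero_eq_mk :
    momentSeries 0 = PowerSeries.mk fun n => (motzkinNumber n : ℚ) := by
  ext n
  simp [coeff_momentSeries, motzkinPowerSum_zero]

open PowerSeries in
theorem hasRationalForm_motzkinNumber_succ : HasRationalForm (momentSeries 0) 0 1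
    (PowerSeries.mk fun n => (motzkinNumber (n + 1) : ℚ)) := by
  have h : momentSeries 0 = X * (PowerSeries.mk fun n => (motzkinNumber (n + 1) : ℚ)) + 1 := by
    ext n
    rw [momentSeries_zero_eq_mk]
    cases n with
    | zero => simp [motzkinNumber]
    | succ n => simp [coeff_succ_X_mul, coeff_one]
  have h2 : (PowerSeries.mk fun n => (motzkinNumber (n + 1) : ℚ)) =
      momentSeries 0 * (1 + X * momentSeries 0) := by
    have hX : (X : PowerSeries ℚ) ≠ 0 := X_ne_zero
    refine mul_left_cancel₀ hX ?_
    linear_combination momentSeries_zero_eq - h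
  rw [h2]
  exact HasRationalForm.tail

/-- Both generating functions have the rational form with `e = 3 r` and `δ = 1`, so that they agree
if their first `6 r + 2` coefficients do. -/
theorem motzkinPowerSum_eq_of_forall_lt {r : ℕ} {Q₁ Q₂ Q₃ Q₄ : Polynomial ℚ}
    (h₁ : 2 * Q₁.natDegree ≤ 3 * r) (h₂ : 2 * Q₂.natDegree ≤ 3 * r)
    (h₃ : 2 * Q₃.natDegree + 2 ≤ 3 * r) (h₄ : 2 * Q₄.natDegree + 2 ≤ 3 * r)
    (h : ∀ n < 6 * r + 2, motzkinPowerSum r n =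
      Q₁.eval (n : ℚ) * motzkinNumber n + Q₂.eval (n : ℚ) * motzkinNumber (n + 1) +
        Q₃.eval (n : ℚ) * 3 ^ n + Q₄.eval (n : ℚ) * (-1) ^ n) (n : ℕ) :
    motzkinPowerSum r n =
      Q₁.eval (n : ℚ) * motzkinNumber n + Q₂.eval (n : ℚ) * motzkinNumber (n + 1) +
        Q₃.eval (n : ℚ) * 3 ^ n + Q₄.eval (n : ℚ) * (-1) ^ n := by
  have hw := momentSeries_zero_eq
  have hself : HasRationalForm (momentSeries 0) 0 0
      (PowerSeries.mk fun n => (motzkinNumber n : ℚ)) := by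
    rw [← momentSeries_zero_eq_mk]
    exact HasRationalForm.self
  have f₁ := ((hself.eval_mul hw (Q := Q₁) le_rfl).mono (e' := 3 * r) (δ' := 1)
    (by omega) (by omega))
  have f₂ := ((hasRationalForm_motzkinNumber_succ.eval_mul hw (Q := Q₂) le_rfl).mono
    (e' := 3 * r) (δ' := 1) (by omega) (by omega))
  have f₃ := (((hasRationalForm_three_pow hw).eval_mul hw (Q := Q₃) le_rfl).mono
    (e' := 3 * r) (δ' := 1) (by omega) (by omega))
  have f₄ := (((hasRationalForm_neg_one_pow hw).eval_mul hw (Q := Q₄) le_rfl).mono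
    (e' := 3 * r) (δ' := 1) (by omega) (by omega))
  have f := ((hasRationalForm_momentSeries r).smul (-r.factorial : ℚ)).mono
    (e' := 3 * r) (δ' := 1) (by omega) (by omega)
  have hr : (r.factorial : ℚ) ≠ 0 := by exact_mod_cast r.factorial_ne_zero
  have hcoeff : ∀ m, PowerSeries.coeff m ((-r.factorial : ℚ) • momentSeries r) =
      -motzkinPowerSum r m := by
    intro m
    rw [PowerSeries.coeff_smul, coeff_momentSeries, smul_eq_mul]
    field_simp
  have h0 := ((((f₁.add f₂).add f₃).add f₄).add f).eq_zero hw fun m hm => by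
    simp only [map_add, PowerSeries.coeff_mk, hcoeff]
    rw [h m (by omega)]
    ring
  have h1 := congrArg (PowerSeries.coeff n) h0
  simp only [map_add, PowerSeries.coeff_mk, hcoeff, map_zero] at h1
  linarith

/-! ### The finite verification -/

/-- The sum of `area ^ r * (area choose j)` over the Motzkin paths of length `n`. -/
def mixedMoment (n r j : ℕ) : ℕ :=
  ∑ s ∈ motzkinPaths n, latticeArea s ^ r * (latticeArea s).choose j

theorem mixedMoment_zero_zero (n : ℕ) : mixedMoment n 0 0 = motzkinNumber n := by
  rw [← areaGF_one_eq_motzkinNumber, ← sum_pow_latticeArea]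
  simp [mixedMoment]

theorem cast_mixedMoment_zero (n r : ℕ) : (mixedMoment n r 0 : ℚ) = motzkinPowerSum r n := by
  rw [mixedMoment, motzkinPowerSum]
  push_cast
  exact Finset.sum_congr rfl fun s hs => by simp [pathArea_eq_latticeArea hs]

theorem mixedMoment_succ (n r j : ℕ) :
    mixedMoment n (r + 1) j = j * mixedMoment n r j + (j + 1) * mixedMoment n r (j + 1) := by
  simp only [mixedMoment, Finset.mul_sum, ← Finset.sum_add_distrib]
  refine Finset.sum_congr rfl fun s _ => ?_
  generalize latticeArea s = x
  have h : x * x.choose j = j * x.choose j + (j + 1) * x.choose (j + 1) := by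
    rcases le_or_gt j x with hj | hj
    · rw [mul_comm (j + 1), Nat.choose_succ_right_eq, mul_comm _ (x - j), ← add_mul,
        Nat.add_sub_cancel' hj]
    · simp [Nat.choose_eq_zero_of_lt hj, Nat.choose_eq_zero_of_lt (hj.trans j.lt_succ_self)]
  rw [pow_succ, mul_assoc, h]
  ring

theorem pathHeight_le {n : ℕ} (s : Fin n → SignType) (k : ℕ) : pathHeight s k ≤ n := by
  have h : ∀ d : SignType, (d : ℤ) ≤ 1 := by decide
  calc pathHeight s k ≤ ∑ _i ∈ Finset.univ.filter (fun i : Fin n => (i : ℕ) < k), (1 : ℤ) :=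
        Finset.sum_le_sum fun i _ => h (s i)
    _ ≤ n := by
        rw [Finset.sum_const, nsmul_eq_mul, mul_one]
        exact_mod_cast (Finset.card_le_univ _).trans (Fintype.card_fin n).le

theorem latticeArea_le {n : ℕ} (s : Fin n → SignType) : latticeArea s ≤ n * n := by
  have := Finset.sum_le_card_nsmul (Finset.range n) (fun k => (pathHeight s k).toNat) n
    fun k _ => by have := pathHeight_le s k; omega
  simpa [latticeArea] using this

theorem mixedMoment_zero_le (n j : ℕ) : mixedMoment n 0 j ≤ 3 ^ n * (n * n) ^ j := by
  have h1 : (motzkinPaths n).card ≤ 3 ^ n := by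
    refine (Finset.card_le_univ _).trans ?_
    rw [Fintype.card_fun, Fintype.card_fin]
    exact le_of_eq (congrArg (· ^ n) (by decide))
  have h2 := Finset.sum_le_card_nsmul (motzkinPaths n)
    (fun s => latticeArea s ^ 0 * (latticeArea s).choose j) ((n * n) ^ j) fun s _ => by
      rw [pow_zero, one_mul]
      exact (Nat.choose_le_pow _ _).trans (Nat.pow_le_pow_left (latticeArea_le s) j)
  exact h2.trans (Nat.mul_le_mul_right _ h1)

/-- The binomial theorem, applied to `(1 + b) ^ area`. -/
theorem areaGF_one_add (b n k : ℕ) : ∃ y, areaGF (1 + b) n =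
    ∑ j ∈ Finset.range k, mixedMoment n 0 j * b ^ j + b ^ k * y := by
  refine ⟨∑ s ∈ motzkinPaths n, ∑ i ∈ Finset.range (latticeArea s + 1),
    b ^ i * (latticeArea s).choose (k + i), ?_⟩
  rw [← sum_pow_latticeArea]
  simp only [mixedMoment, Finset.sum_mul, Finset.mul_sum]
  rw [Finset.sum_comm, ← Finset.sum_add_distrib]
  refine Finset.sum_congr rfl fun s _ => ?_
  rw [add_comm 1 b, add_pow, Finset.sum_subset (Finset.range_mono
    (show latticeArea s + 1 ≤ k + (latticeArea s + 1) by omega)) fun j _ hj => by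
      rw [Nat.choose_eq_zero_of_lt (by simpa using hj)]; simp, Finset.sum_range_add]
  congr 1
  · exact Finset.sum_congr rfl fun j _ => by simp [mul_comm]
  · exact Finset.sum_congr rfl fun j _ => by simp [pow_add, mul_assoc]

/-- The `k` lowest digits of a number in base `b`, the lowest one first. -/
def lowDigits (b : ℕ) : ℕ → ℕ → List ℕ
  | 0, _ => []
  | k + 1, x => x % b :: lowDigits b k (x / b)

theorem lowDigits_mod (b k x : ℕ) : lowDigits b k (x % b ^ k) = lowDigits b k x := by
  induction k generalizing x with
  | zero => rfl
  | succ k ih =>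
    rw [lowDigits, lowDigits, Nat.mod_mod_of_dvd x (dvd_pow_self b k.succ_ne_zero), pow_succ',
      Nat.mod_mul_right_div_self, ih]

theorem lowDigits_sum {b : ℕ} (k m y : ℕ) {e : ℕ → ℕ} (he : ∀ j < m + k, e j < b) :
    lowDigits b k (∑ j ∈ Finset.range k, e (m + j) * b ^ j + b ^ k * y) =
      (List.range' m k).map e := by
  induction k generalizing m with
  | zero => rfl
  | succ k ih =>
    have hm := he m (by omega)
    have h : ∑ j ∈ Finset.range (k + 1), e (m + j) * b ^ j + b ^ (k + 1) * y =
        e m + b * (∑ j ∈ Finset.range k, e (m + 1 + j) * b ^ j + b ^ k * y) := by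
      rw [Finset.sum_range_succ', mul_add, Finset.mul_sum, add_zero, pow_zero, mul_one]
      rw [Finset.sum_congr rfl fun j _ => show e (m + (j + 1)) * b ^ (j + 1) =
        b * (e (m + 1 + j) * b ^ j) by rw [add_right_comm, add_assoc]; ring]
      ring
    rw [lowDigits, h, Nat.add_mul_mod_self_left, Nat.mod_eq_of_lt hm,
      Nat.add_mul_div_left _ _ (by omega), Nat.div_eq_of_lt hm, zero_add,
      ih (m + 1) fun j hj => he j (by omega), List.range'_succ, List.map_cons]

/-- The inner product of two lists. -/
def natDot : List ℕ → List ℕ → ℕ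
  | a :: p, b :: q => a * b + natDot p q
  | _, _ => 0

theorem natDot_map_range (f g : ℕ → ℕ) (n : ℕ) :
    natDot ((List.range n).map f) ((List.range n).map g) =
      ∑ k ∈ Finset.range n, f k * g k := by
  induction n generalizing f g with
  | zero => rfl
  | succ n ih =>
    rw [List.range_succ_eq_map, List.map_cons, List.map_cons, natDot, List.map_map, List.map_map,
      ih, Finset.sum_range_succ', add_comm]
    rfl

/-- A base so large that the sums of `(area choose j)`, `j ≤ 20`, over the Motzkin paths of length
at most `122` are digits. -/
def packBase : ℕ := 2 ^ 512

/-- The modulus that retains the digits `0, …, 20` in base `packBase`. -/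
def packModulus : ℕ := packBase ^ 21

/-- The map `(e_j)_j ↦ (j e_j + (j + 1) e_{j+1})_j` on lists whose first entry has index `j`; it
takes the sums of `area ^ r * (area choose j)` to those of `area ^ (r + 1) * (area choose j)`. -/
def timesArea : ℕ → List ℕ → List ℕ
  | j, a :: b :: l => (j * a + (j + 1) * b) :: timesArea (j + 1) (b :: l)
  | _, _ => []

theorem timesArea_map_range' (n r m k : ℕ) :
    timesArea m ((List.range' m (k + 1)).map (mixedMoment n r)) =
      (List.range' m k).map (mixedMoment n (r + 1)) := by
  induction k generalizing m with
  | zero => rfl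
  | succ k ih =>
    have := ih (m + 1)
    rw [List.range'_succ, List.map_cons] at this
    rw [List.range'_succ, List.range'_succ, List.map_cons, List.map_cons, timesArea, this,
      List.range'_succ, List.map_cons, mixedMoment_succ]

/-- The value at `x` of the polynomial with the list of coefficients `l`, constant term first. -/
def horner (x : ℤ) (l : List ℤ) : ℤ := l.foldr (fun a p => a + x * p) 0

/-- The fold in `tablePolynomial` runs over the list of coefficients cast to `ℚ`. -/
theorem tablePolynomial_mk (d : ℕ) (l : List ℤ) : tablePolynomial (d, l) =
    Polynomial.C (1 / (d : ℚ)) *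
      l.foldr (fun (a : ℤ) (p : Polynomial ℚ) => Polynomial.C (a : ℚ) + Polynomial.X * p) 0 := by
  have h : (do let a ← l; pure (a : ℚ)) = l.map (Int.cast : ℤ → ℚ) :=
    List.flatMap_pure_eq_map _ l
  rw [tablePolynomial, h, List.foldr_map]

theorem eval_tablePolynomial (t : ℕ × List ℤ) (n : ℕ) :
    (tablePolynomial t).eval (n : ℚ) = (horner n t.2 : ℚ) / t.1 := by
  obtain ⟨d, l⟩ := t
  rw [tablePolynomial_mk, Polynomial.eval_mul, Polynomial.eval_C, one_div, div_eq_inv_mul]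
  congr 1
  induction l with
  | nil => simp [horner]
  | cons a l ih =>
    simp only [horner, List.foldr_cons] at ih ⊢
    simp only [Polynomial.eval_add, Polynomial.eval_C, Polynomial.eval_mul, Polynomial.eval_X, ih]
    push_cast
    rfl

theorem natDegree_tablePolynomial_le (t : ℕ × List ℤ) :
    (tablePolynomial t).natDegree ≤ t.2.length - 1 := by
  obtain ⟨d, l⟩ := t
  rw [tablePolynomial_mk]
  refine (Polynomial.natDegree_C_mul_le _ _).trans ?_
  induction l with
  | nil => simp
  | cons a l ih =>
    cases l with
    | nil => simp
    | cons b l =>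
      simp only [List.foldr_cons, List.length_cons] at ih ⊢
      refine Polynomial.natDegree_add_le_of_degree_le (by simp) ?_
      refine Polynomial.natDegree_mul_le.trans ?_
      rw [Polynomial.natDegree_X]
      omega

/-- The claimed formula for `v = M_r(n)` with `a = M_n` and `b = M_{n+1}`, cleared of
denominators. -/
def checkEntry (r n a b v : ℕ) : Bool :=
  let t₁ := motzkinTable1 r
  let t₂ := motzkinTable2 r
  let t₃ := motzkinTable3 r
  let t₄ := motzkinTable4 r
  (v * (t₁.1 * t₂.1 * t₃.1 * t₄.1) : ℤ) ==
    horner n t₁.2 * a * (t₂.1 * t₃.1 * t₄.1) + horner n t₂.2 * b * (t₁.1 * t₃.1 * t₄.1)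
    + horner n t₃.2 * 3 ^ n * (t₁.1 * t₂.1 * t₄.1)
    + horner n t₄.2 * (-1) ^ n * (t₁.1 * t₂.1 * t₃.1)

/-- The formulas for `k` consecutive exponents from `r` on, at the length `n`; those with `n ≥ 6 r
+ 2` are skipped. The list `l` holds the sums of `area ^ r * (area choose j)` for `j < k`. -/
def checkLength (n a b : ℕ) : ℕ → ℕ → List ℕ → Bool
  | 0, _, _ => true
  | k + 1, r, l =>
    (Nat.ble (6 * r + 2) n || checkEntry r n a b (l.headD 0)) &&
      checkLength n a b k (r + 1) (timesArea 0 l)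

/-- The formulas for `k` consecutive lengths from `n` on. The list `as` holds `A_n, …, A_0` and `cs`
holds `q A_0, …, q ^ n A_{n-1}`, modulo `packModulus` and with `q = 1 + packBase`. -/
def checkFrom : ℕ → ℕ → List ℕ → List ℕ → Bool
  | 0, _, _, _ => true
  | k + 1, n, as, cs =>
    let a := as.headD 0
    let a' := (a + natDot cs as.tail) % packModulus
    checkLength n (a % packBase) (a' % packBase) 20 1 (timesArea 0 (lowDigits packBase 21 a)) &&
      checkFrom k (n + 1) (a' :: as) (cs ++ [(1 + packBase) ^ (n + 1) * a % packModulus])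

/-- All lengths that are needed for `r ≤ 20`, namely `n < 6 * 20 + 2`. -/
theorem checkFrom_eq_true : checkFrom 122 0 [1] [] = true := by
  decide +kernel

theorem motzkinTable_bounds : ∀ r < 21, 1 ≤ r →
    ((motzkinTable1 r).1 ≠ 0 ∧ (motzkinTable2 r).1 ≠ 0 ∧ (motzkinTable3 r).1 ≠ 0 ∧
      (motzkinTable4 r).1 ≠ 0) ∧
    2 * ((motzkinTable1 r).2.length - 1) ≤ 3 * r ∧ 2 * ((motzkinTable2 r).2.length - 1) ≤ 3 * r ∧
    2 * ((motzkinTable3 r).2.length - 1) + 2 ≤ 3 * r ∧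
    2 * ((motzkinTable4 r).2.length - 1) + 2 ≤ 3 * r := by
  decide +kernel

theorem eq_of_checkEntry {r n a b v : ℕ} (hr : 1 ≤ r) (hr' : r < 21)
    (h : checkEntry r n a b v = true) :
    (v : ℚ) = (motzkinQ1 r).eval (n : ℚ) * a + (motzkinQ2 r).eval (n : ℚ) * b +
      (motzkinQ3 r).eval (n : ℚ) * 3 ^ n + (motzkinQ4 r).eval (n : ℚ) * (-1) ^ n := by
  obtain ⟨⟨h₁, h₂, h₃, h₄⟩, -⟩ := motzkinTable_bounds r hr' hr
  rw [checkEntry, beq_iff_eq] at h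
  simp only [motzkinQ1, motzkinQ2, motzkinQ3, motzkinQ4, eval_tablePolynomial]
  have h' := congrArg (Int.cast : ℤ → ℚ) h
  push_cast at h'
  have h₁' : ((motzkinTable1 r).1 : ℚ) ≠ 0 := by exact_mod_cast h₁
  have h₂' : ((motzkinTable2 r).1 : ℚ) ≠ 0 := by exact_mod_cast h₂
  have h₃' : ((motzkinTable3 r).1 : ℚ) ≠ 0 := by exact_mod_cast h₃
  have h₄' : ((motzkinTable4 r).1 : ℚ) ≠ 0 := by exact_mod_cast h₄
  field_simp
  linear_combination h'

theorem checkEntry_of_checkLength {n a b k r : ℕ}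
    (h : checkLength n a b k r ((List.range' 0 k).map (mixedMoment n r)) = true) :
    ∀ r', r ≤ r' → r' < r + k → n < 6 * r' + 2 →
      checkEntry r' n a b (mixedMoment n r' 0) = true := by
  induction k generalizing r with
  | zero => intro r' h1 h2; omega
  | succ k ih =>
    rw [checkLength, timesArea_map_range', Bool.and_eq_true, Bool.or_eq_true, Nat.ble_eq] at h
    intro r' h1 h2 h3
    rcases h1.eq_or_lt with rfl | h1
    · exact h.1.resolve_left (by omega)
    · exact ih h.2 r' h1 (by omega) h3

theorem mixedMoment_lt_packBase {n j : ℕ} (hn : n ≤ 122) (hj : j ≤ 20) :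
    mixedMoment n 0 j < packBase := by
  have h1 : (n * n) ^ j ≤ (122 * 122) ^ 20 :=
    (Nat.pow_le_pow_left (Nat.mul_le_mul hn hn) j).trans (Nat.pow_le_pow_right (by norm_num) hj)
  have h2 : 3 ^ n ≤ 3 ^ 122 := Nat.pow_le_pow_right (by norm_num) hn
  refine (mixedMoment_zero_le n j).trans_lt ((Nat.mul_le_mul h2 h1).trans_lt ?_)
  decide +kernel

theorem lowDigits_areaGF {n : ℕ} (hn : n ≤ 122) :
    lowDigits packBase 21 (areaGF (1 + packBase) n % packModulus) =
      (List.range' 0 21).map (mixedMoment n 0) := by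
  obtain ⟨y, hy⟩ := areaGF_one_add packBase n 21
  rw [packModulus, lowDigits_mod, hy]
  have := lowDigits_sum 21 0 y (b := packBase) (e := mixedMoment n 0)
    fun j hj => mixedMoment_lt_packBase hn (by omega)
  simpa only [zero_add] using this

theorem areaGF_mod_packBase {n : ℕ} (hn : n ≤ 122) :
    areaGF (1 + packBase) n % packModulus % packBase = motzkinNumber n := by
  have h := congrArg List.head? (lowDigits_areaGF hn)
  rw [lowDigits, List.range'_succ, List.map_cons, List.head?_cons, List.head?_cons,
    mixedMoment_zero_zero] at h
  exact Option.some.inj h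

theorem areaGF_succ_mod (q m n : ℕ) :
    (areaGF q n % m + natDot ((List.range n).map fun k => q ^ (k + 1) * areaGF q k % m)
      ((List.range n).map fun k => areaGF q (n - 1 - k) % m)) % m = areaGF q (n + 1) % m := by
  rw [natDot_map_range, areaGF_succ]
  refine Nat.ModEq.add (Nat.mod_modEq _ _) ?_
  rw [Nat.ModEq, Finset.sum_nat_mod, Finset.sum_nat_mod (Finset.range n) m fun k =>
    q ^ (k + 1) * areaGF q k * areaGF q (n - 1 - k)]
  congr 1
  exact Finset.sum_congr rfl fun k _ => (Nat.mod_modEq _ _).mul (Nat.mod_modEq _ _)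

theorem checkEntry_of_checkFrom {k n : ℕ} (hk : n + k ≤ 122)
    (h : checkFrom k n
      ((List.range (n + 1)).map fun i => areaGF (1 + packBase) (n - i) % packModulus)
      ((List.range n).map fun i =>
        (1 + packBase) ^ (i + 1) * areaGF (1 + packBase) i % packModulus) = true) :
    ∀ m, n ≤ m → m < n + k → ∀ r, 1 ≤ r → r < 21 → m < 6 * r + 2 →
      checkEntry r m (motzkinNumber m) (motzkinNumber (m + 1)) (mixedMoment m r 0) = true := by
  induction k generalizing n with
  | zero => intro m h1 h2; omega
  | succ k ih =>
    have htail : ((List.range (n + 1)).map fun i =>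
        areaGF (1 + packBase) (n - i) % packModulus).tail =
        (List.range n).map fun i => areaGF (1 + packBase) (n - 1 - i) % packModulus := by
      rw [List.range_succ_eq_map, List.map_cons, List.tail_cons, List.map_map]
      refine List.map_congr_left fun i _ => ?_
      simp only [Function.comp_apply]
      rw [show n - i.succ = n - 1 - i by omega]
    have hhead : ((List.range (n + 1)).map fun i =>
        areaGF (1 + packBase) (n - i) % packModulus).headD 0 =
        areaGF (1 + packBase) n % packModulus := by
      rw [List.range_succ_eq_map, List.map_cons, List.headD_cons, Nat.sub_zero]
    rw [checkFrom] at h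
    simp only [htail, hhead, areaGF_succ_mod, areaGF_mod_packBase (show n ≤ 122 by omega),
      areaGF_mod_packBase (show n + 1 ≤ 122 by omega), lowDigits_areaGF (show n ≤ 122 by omega),
      timesArea_map_range', Bool.and_eq_true] at h
    intro m h1 h2 r hr hr' hm
    rcases h1.eq_or_lt with rfl | h1
    · exact checkEntry_of_checkLength h.1 r hr (by omega) hm
    · refine ih (n := n + 1) (by omega) ?_ m h1 (by omega) r hr hr' hm
      convert h.2 using 1
      congr 1
      · rw [List.range_succ_eq_map (n := n + 1), List.map_cons, List.map_map]
        simp [Function.comp_def]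
      · rw [List.range_succ, List.map_append, List.map_singleton]
        simp [Nat.mul_mod]

theorem motzkinPowerSum_eq {r : ℕ} (hr : 1 ≤ r) (hr' : r ≤ 20) (n : ℕ) :
    motzkinPowerSum r n =
      (motzkinQ1 r).eval (n : ℚ) * motzkinNumber n
      + (motzkinQ2 r).eval (n : ℚ) * motzkinNumber (n + 1)
      + (motzkinQ3 r).eval (n : ℚ) * 3 ^ n + (motzkinQ4 r).eval (n : ℚ) * (-1) ^ n := by
  obtain ⟨-, h₁, h₂, h₃, h₄⟩ := motzkinTable_bounds r (Nat.lt_succ_of_le hr') hr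
  have d₁ := natDegree_tablePolynomial_le (motzkinTable1 r)
  have d₂ := natDegree_tablePolynomial_le (motzkinTable2 r)
  have d₃ := natDegree_tablePolynomial_le (motzkinTable3 r)
  have d₄ := natDegree_tablePolynomial_le (motzkinTable4 r)
  refine motzkinPowerSum_eq_of_forall_lt (r := r) ?_ ?_ ?_ ?_ (fun m hm => ?_) n
  · rw [motzkinQ1]; omega
  · rw [motzkinQ2]; omega
  · rw [motzkinQ3]; omega
  · rw [motzkinQ4]; omega
  · rw [← cast_mixedMoment_zero]
    refine eq_of_checkEntry hr (by omega) (checkEntry_of_checkFrom (k := 122) (n := 0) le_rfl ?_ m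
      (Nat.zero_le _) (by omega) r hr (by omega) hm)
    have h1 : 1 % packModulus = 1 := Nat.mod_eq_of_lt (by norm_num [packModulus, packBase])
    simpa [areaGF_zero, h1] using checkFrom_eq_true

/-! ### The explicit formulas -/

theorem mainTheorem2 :
    (∀ n : ℕ, motzkinPowerSum 0 n = (motzkinNumber n : ℚ)) ∧
    (∀ r : ℕ, 1 ≤ r → r ≤ 20 → ∀ n : ℕ,
      motzkinPowerSum r n =
        (motzkinQ1 r).eval (n : ℚ) * (motzkinNumber n : ℚ)
        + (motzkinQ2 r).eval (n : ℚ) * (motzkinNumber (n + 1) : ℚ)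
        + (motzkinQ3 r).eval (n : ℚ) * (3 : ℚ) ^ n
        + (motzkinQ4 r).eval (n : ℚ) * (-1 : ℚ) ^ n) ∧
    (∀ n : ℕ,
      motzkinPowerSum 1 n =
        (-(n : ℚ) - 1) * (motzkinNumber n : ℚ) + (3 : ℚ) ^ (n + 1) / 4 + (-1 : ℚ) ^ n / 4) ∧
    (∀ n : ℕ,
      motzkinPowerSum 2 n =
        (25 / 36 * (n : ℚ) ^ 3 + 11 / 3 * (n : ℚ) ^ 2 + 191 / 36 * (n : ℚ) + 7 / 3)
          * (motzkinNumber n : ℚ)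
        + (-(5 / 36) * (n : ℚ) ^ 3 - 2 / 3 * (n : ℚ) ^ 2 - 31 / 36 * (n : ℚ) - 1 / 3)
          * (motzkinNumber (n + 1) : ℚ)
        + (-(3 * (n : ℚ) / 2) - 3 / 2) * (3 : ℚ) ^ n
        + (-((n : ℚ) / 2) - 1 / 2) * (-1 : ℚ) ^ n) ∧
    (∀ n : ℕ,
      motzkinPowerSum 3 n =
        (-(25 / 12) * (n : ℚ) ^ 4 - 133 / 12 * (n : ℚ) ^ 3 - 251 / 12 * (n : ℚ) ^ 2
            - 203 / 12 * (n : ℚ) - 5) * (motzkinNumber n : ℚ)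
        + (5 / 12 * (n : ℚ) ^ 4 + 29 / 12 * (n : ℚ) ^ 3 + 55 / 12 * (n : ℚ) ^ 2
            + 43 / 12 * (n : ℚ) + 1) * (motzkinNumber (n + 1) : ℚ)
        + (15 / 64 * (n : ℚ) ^ 3 + 207 / 64 * (n : ℚ) ^ 2 + 1521 / 256 * (n : ℚ) + 1503 / 512)
          * (3 : ℚ) ^ n
        + (15 / 64 * (n : ℚ) ^ 3 + 93 / 64 * (n : ℚ) ^ 2 + 585 / 256 * (n : ℚ) + 545 / 512)
          * (-1 : ℚ) ^ n) ∧
    (∀ n : ℕ,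
      motzkinPowerSum 4 n =
        (221 / 324 * (n : ℚ) ^ 6 + 31441 / 3780 * (n : ℚ) ^ 5 + 411613 / 11340 * (n : ℚ) ^ 4
            + 72251 / 945 * (n : ℚ) ^ 3 + 34189 / 405 * (n : ℚ) ^ 2 + 59401 / 1260 * (n : ℚ)
            + 3314 / 315) * (motzkinNumber n : ℚ)
        + (-(221 / 1134) * (n : ℚ) ^ 6 - 1409 / 630 * (n : ℚ) ^ 5 - 27248 / 2835 * (n : ℚ) ^ 4
            - 10781 / 540 * (n : ℚ) ^ 3 - 122653 / 5670 * (n : ℚ) ^ 2 - 6349 / 540 * (n : ℚ)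
            - 794 / 315) * (motzkinNumber (n + 1) : ℚ)
        + (-(15 / 16) * (n : ℚ) ^ 4 - 63 / 8 * (n : ℚ) ^ 3 - 1197 / 64 * (n : ℚ) ^ 2
            - 2241 / 128 * (n : ℚ) - 735 / 128) * (3 : ℚ) ^ n
        + (-(15 / 16) * (n : ℚ) ^ 4 - 19 / 4 * (n : ℚ) ^ 3 - 573 / 64 * (n : ℚ) ^ 2
            - 947 / 128 * (n : ℚ) - 289 / 128) * (-1 : ℚ) ^ n) := by
  refine ⟨motzkinPowerSum_zero, fun r hr hr' n => motzkinPowerSum_eq hr hr' n, fun n => ?_,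
    fun n => ?_, fun n => ?_, fun n => ?_⟩
  all_goals
    rw [motzkinPowerSum_eq (by norm_num) (by norm_num)]
    simp only [motzkinQ1, motzkinQ2, motzkinQ3, motzkinQ4, eval_tablePolynomial, motzkinTable1,
      motzkinTable2, motzkinTable3, motzkinTable4, horner, List.foldr_cons, List.foldr_nil]
    push_cast
    ring
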